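/- Let $d\ge 1$ and $n\ge 1$ be integers. Let $\mathbb B_d$ be the open Euclidean unit ball of $\mathbb C^d$, with $\langle z,w\rangle=\sum_j z_j\overline{w_j}$, and let $H^2_d$ be the Drury–Arveson space, that is, the completion of $\mathbb C[z_1,\dots,z_d]$ for the inner product $\langle z^\alpha,z^\beta\rangle=\delta_{\alpha,\beta}\,\alpha!/|\alpha|!$, regarded as a Hilbert space of functions on $\mathbb B_d$. Let $\mathcal M_d$ be its multiplier algebra, let $M_f$ denote multiplication by $f\in\mathcal M_d$, and let $M_z=(M_{z_1},\dots,M_{z_d})$. Put $$\mathbb P_{d,n}=\{P\in B(H^2_d) : P=P^2=P^*,\ PM_f^*P=M_f^*P\ \text{for all } f\in\mathcal M_d,\ \dim PH^2_d=n\},$$ with the topology of the operator norm. Let $\mathbb X_{d,n}=\mathbb B_d^n/S_n$ be the symmetrized polyball; its points are identified with formal sums $\sum_\lambda m_\lambda[\lambda]$ of points $\lambda\in\mathbb B_d$ with coefficients $m_\lambda\in\{0,1,2,\dots\}$ and $\sum_\lambda m_\lambda=n$. It carries the symmetric distance $$d_s([X],[Y])=\min_{\sigma\in S_n}\ \max_{1\le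 j\le n}\|\varphi_{x_j}(y_{\sigma(j)})\|,$$ where $\varphi_\lambda(z)=\dfrac{\lambda-P_\lambda z-\sqrt{1-\|\lambda\|^2}\,(z-P_\lambda z)}{1-\langle z,\lambda\rangle}$ with $P_\lambda z=\|\lambda\|^{-2}\langle z,\lambda\rangle\lambda$ for $\lambda\neq0$ and $P_0=0$. For a commuting tuple $A=(A_1,\dots,A_d)$ of linear operators on an $n$-dimensional complex vector space, let $\sigma(A)=\{\lambda\in\mathbb C^d : \bigcap_j\ker(A_j-\lambda_jI)\ne\{0\}\}$, let $R_\lambda(A)=\bigcap_{|\alpha|=n}\ker (A-\lambda I)^\alpha$, and let $\sigma_J(A)=\sum_{\lambda\in\sigma(A)}\dim R_\lambda(A)\,[\lambda]$. Then $\Psi_{d,n}(P)=\sigma_J(PM_z|_{PH^2_d})$ is a well-defined map $\Psi_{d,n}:\mathbb P_{d,n}\to\mathbb X_{d,n}$ (that is, the joint spectrum of the compressed shift lies in $\mathbb B_d$ and its multiplicities add up to $n$), and it is surjective and continuous with respect to the operator norm on $\mathbb P_{d,n}$ and the distance $d_s$ on $\mathbb X_{d,n}$. -/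

import Mathlib

noncomputable section

namespace DruryArveson

/-- The open unit ball of `ℂ^d` with the Euclidean norm. -/
abbrev Ball (d : ℕ) : Type := ↥(Metric.ball (0 : EuclideanSpace ℂ (Fin d)) 1)

/-! ### The symmetrized polyball and the symmetric distance -/

/-- The automorphism `φ_l` of the ball that exchanges `l` and `0`,
`φ_l(z) = (l - P_l z - √(1 - ‖l‖²) (z - P_l z)) / (1 - ⟨z, l⟩)`, where `P_l z = ‖l‖⁻² ⟨z, l⟩ l`
and `⟨z, l⟩ = ∑ z_j conj(l_j)`, which is `inner ℂ l z` in Mathlib's convention.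
For `l = 0` one has `P_l = 0` and the formula gives `φ_0(z) = -z`. -/
def ballInvolution {d : ℕ} (l z : EuclideanSpace ℂ (Fin d)) : EuclideanSpace ℂ (Fin d) :=
  let Plz : EuclideanSpace ℂ (Fin d) := (inner ℂ l z / ((‖l‖ ^ 2 : ℝ) : ℂ)) • l
  (1 - inner ℂ l z)⁻¹ • (l - Plz - ((√(1 - ‖l‖ ^ 2) : ℝ) : ℂ) • (z - Plz))

/-- The pseudohyperbolic distance `‖φ_z(w)‖` on the ball. -/
def phDist {d : ℕ} (z w : Ball d) : ℝ := ‖ballInvolution (z : EuclideanSpace ℂ (Fin d)) w‖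

/-- Two `n`-tuples of points of the ball are equivalent if they differ by a permutation. -/
def permSetoid (d n : ℕ) : Setoid (Fin n → Ball d) where
  r x y := ∃ s : Equiv.Perm (Fin n), y = x ∘ s
  iseqv :=
    { refl := fun x => ⟨1, rfl⟩
      symm := by
        rintro x y ⟨s, rfl⟩
        exact ⟨s⁻¹, by ext i; simp⟩
      trans := by
        rintro x y z ⟨s, rfl⟩ ⟨t, rfl⟩
        exact ⟨s * t, rfl⟩ }

/-- The symmetrized polyball: the quotient of the `n`-fold product of the ball by the
symmetric group. -/
def SymPolyball (d n : ℕ) : Type := Quotient (permSetoid d n)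

/-- `max_j d_ph(x_j, y_j)` on the polyball. -/
def polyDist {d n : ℕ} (x y : Fin n → Ball d) : ℝ := ⨆ j, phDist (x j) (y j)

/-- The symmetric distance: the minimum over all permutations `s` of `max_j d_ph(x_j, y_{s j})`. -/
def symDist {d n : ℕ} (X Y : SymPolyball d n) : ℝ :=
  Quotient.liftOn₂ X Y
    (fun x y => ⨅ s : Equiv.Perm (Fin n), polyDist x (y ∘ s))
    (by
      rintro x y _ _ ⟨s, rfl⟩ ⟨t, rfl⟩
      have key : ∀ u : Equiv.Perm (Fin n),
          polyDist (x ∘ s) ((y ∘ t) ∘ u) = polyDist x (y ∘ (t * u * s⁻¹ : Equiv.Perm (Fin n))) := by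
        intro u
        unfold polyDist
        rw [← s.iSup_comp (g := fun j =>
          phDist (x j) ((y ∘ (t * u * s⁻¹ : Equiv.Perm (Fin n))) j))]
        simp
      simp only [key]
      exact (((Equiv.mulLeft t).trans (Equiv.mulRight s⁻¹)).iInf_comp
        (g := fun u : Equiv.Perm (Fin n) => polyDist x (y ∘ u))).symm)

/-- The multiplicity of a point `l` of `ℂ^d` in the class of `(x_1, …, x_n)`, that is, the
coefficient of `[l]` in the formal sum `[x_1] + … + [x_n]`. -/
def SymPolyball.mult {d n : ℕ} (X : SymPolyball d n) (l : EuclideanSpace ℂ (Fin d)) : ℕ :=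
  Quotient.liftOn X
    (fun x => Nat.card {j : Fin n // (x j : EuclideanSpace ℂ (Fin d)) = l})
    (by
      rintro x _ ⟨s, rfl⟩
      exact (Nat.card_congr (s.subtypeEquiv (fun _ => Iff.rfl))).symm)

/-! ### Joint spectrum with multiplicities of a tuple of endomorphisms -/

section JointSpectrum

variable {d : ℕ} {V : Type*} [AddCommGroup V] [Module ℂ V]

/-- The joint spectrum: all `l` such that the endomorphisms `A_j - l_j` have a common nonzero
kernel vector. -/
def jointSpectrum (A : Fin d → Module.End ℂ V) : Set (EuclideanSpace ℂ (Fin d)) :=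
  {l | (⨅ j, LinearMap.ker (A j - l j • (1 : Module.End ℂ V))) ≠ ⊥}

/-- `A^α = A_1^{α_1} ⋯ A_d^{α_d}` -/
def tuplePow (A : Fin d → Module.End ℂ V) (α : Fin d → ℕ) : Module.End ℂ V :=
  (List.ofFn fun j => A j ^ α j).prod

/-- The root subspace: the intersection of the kernels of `(A - l)^α` over all multi-indices `α`
with `|α| = dim V`. -/
def rootSubspace (A : Fin d → Module.End ℂ V) (l : EuclideanSpace ℂ (Fin d)) : Submodule ℂ V :=
  ⨅ α : {α : Fin d → ℕ // ∑ j, α j = Module.finrank ℂ V},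
    LinearMap.ker (tuplePow (fun j => A j - l j • (1 : Module.End ℂ V)) α)

open Classical in
/-- The coefficient of `[l]` in the joint spectrum with multiplicities
`∑_{l ∈ σ(A)} dim R_l(A) [l]`. -/
def jointSpectrumMult (A : Fin d → Module.End ℂ V) (l : EuclideanSpace ℂ (Fin d)) : ℕ :=
  if l ∈ jointSpectrum A then Module.finrank ℂ (rootSubspace A l) else 0

end JointSpectrum

/-! ### The Drury–Arveson space -/

/-- `|α|! / α!`, the inverse of the square of the norm of `z^α` in the Drury–Arveson space. -/
def weight {d : ℕ} (α : Fin d → ℕ) : ℝ :=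
  ((∑ j, α j).factorial : ℝ) / ((∏ j, (α j).factorial : ℕ) : ℝ)

/-- The Drury–Arveson space `H²_d`, the completion of the polynomials for the inner product
`⟨z^α, z^β⟩ = δ_{αβ} α!/|α|!`, realized through the coordinates with respect to the orthonormal
basis `z^α / ‖z^α‖ = √(|α|!/α!) z^α`: the vector `f` is the function
`∑_α f_α √(|α|!/α!) z^α` on the ball, see `evalAt`. -/
abbrev DASpace (d : ℕ) : Type := lp (fun _ : Fin d → ℕ => ℂ) 2

/-- The value of `f` at the point `z` of the ball. -/
def evalAt {d : ℕ} (f : DASpace d) (z : Ball d) : ℂ :=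
  ∑' α : Fin d → ℕ, f α * (√(weight α) : ℂ) * ∏ j, (z : EuclideanSpace ℂ (Fin d)) j ^ α j

/-- The monomial `z^α` as a vector of the Drury–Arveson space. -/
def monomial {d : ℕ} (α : Fin d → ℕ) : DASpace d :=
  lp.single 2 α (((√(weight α))⁻¹ : ℝ) : ℂ)

lemma weight_pos {d : ℕ} (α : Fin d → ℕ) : 0 < weight α := by
  unfold weight
  have h1 : 0 < (∑ j, α j).factorial := Nat.factorial_pos _
  have h2 : 0 < ∏ j, (α j).factorial := Finset.prod_pos fun j _ => Nat.factorial_pos _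
  positivity

lemma inner_monomial {d : ℕ} (α β : Fin d → ℕ) :
    inner ℂ (monomial α) (monomial β) =
      if α = β then ((((∏ j, (α j).factorial : ℕ) : ℝ) / ((∑ j, α j).factorial : ℝ) : ℝ) : ℂ)
      else 0 := by
  unfold monomial
  rw [lp.inner_single_left]
  split_ifs with h
  · subst h
    rw [lp.single_apply_self]
    simp only [RCLike.inner_apply, Complex.conj_ofReal, ← Complex.ofReal_mul]
    rw [← mul_inv, Real.mul_self_sqrt (weight_pos α).le]
    simp [weight]
  · rw [lp.single_apply_ne _ _ _ h]
    simp

lemma dense_span_monomial (d : ℕ) :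
    Dense (Submodule.span ℂ (Set.range (monomial (d := d))) : Set (DASpace d)) := by
  intro f
  have hs := lp.hasSum_single (p := 2) (by simp) f
  refine mem_closure_of_tendsto hs (Filter.Eventually.of_forall fun s => ?_)
  refine Submodule.sum_mem _ fun α _ => ?_
  have : lp.single 2 α (f α) = (f α * (√(weight α) : ℂ)) • (monomial α : DASpace d) := by
    unfold monomial
    rw [← lp.single_smul]
    congr 1
    have := (Real.sqrt_pos.2 (weight_pos α)).ne'
    simp [this]
  rw [this]
  exact Submodule.smul_mem _ _ (Submodule.subset_span ⟨α, rfl⟩)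

lemma evalAt_monomial {d : ℕ} (α : Fin d → ℕ) (z : Ball d) :
    evalAt (monomial α) z = ∏ j, (z : EuclideanSpace ℂ (Fin d)) j ^ α j := by
  unfold evalAt
  rw [tsum_eq_single α]
  · have := (Real.sqrt_pos.2 (weight_pos α)).ne'
    simp [monomial, this]
  · intro β hβ
    have h0 : (monomial α : DASpace d) β = 0 := lp.single_apply_ne _ _ _ hβ
    rw [h0, zero_mul, zero_mul]

lemma sum_weight_degree {d : ℕ} (t : Fin d → ℝ) (m : ℕ) :
    ∑ α ∈ Finset.piAntidiag Finset.univ m, weight α * ∏ j, t j ^ α j = (∑ j, t j) ^ m := by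
  rw [Finset.sum_pow_eq_sum_piAntidiag]
  refine Finset.sum_congr rfl fun α hα => ?_
  congr 1
  unfold weight Nat.multinomial
  rw [Nat.cast_div (Nat.prod_factorial_dvd_factorial_sum _ _)]
  exact_mod_cast (Finset.prod_pos fun j _ => Nat.factorial_pos _).ne'

/-- The series that defines the value of `f` at a point of the ball converges absolutely. -/
lemma summable_evalAt {d : ℕ} (f : DASpace d) (z : Ball d) :
    Summable fun α : Fin d → ℕ =>
      f α * (√(weight α) : ℂ) * ∏ j, (z : EuclideanSpace ℂ (Fin d)) j ^ α j := by
  set t : Fin d → ℝ := fun j => ‖(z : EuclideanSpace ℂ (Fin d)) j‖ ^ 2 with ht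
  have hz : ‖(z : EuclideanSpace ℂ (Fin d))‖ < 1 := mem_ball_zero_iff.1 z.2
  have hT : ∑ j, t j < 1 := by
    rw [ht, ← EuclideanSpace.norm_sq_eq]
    exact pow_lt_one₀ (norm_nonneg _) hz two_ne_zero
  have ht0 : ∀ j, 0 ≤ t j := fun j => by positivity
  have hT0 : 0 ≤ ∑ j, t j := Finset.sum_nonneg fun j _ => ht0 j
  have hterm : ∀ α : Fin d → ℕ, 0 ≤ weight α * ∏ j, t j ^ α j := fun α =>
    mul_nonneg (weight_pos α).le (Finset.prod_nonneg fun j _ => pow_nonneg (ht0 j) _)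
  have hw : Summable fun α : Fin d → ℕ => weight α * ∏ j, t j ^ α j := by
    refine summable_of_sum_le (c := ∑' m : ℕ, (∑ j, t j) ^ m) hterm fun s => ?_
    classical
    set D : Finset ℕ := s.image fun α => ∑ j, α j
    calc ∑ α ∈ s, weight α * ∏ j, t j ^ α j
        ≤ ∑ α ∈ D.biUnion fun m => Finset.piAntidiag Finset.univ m, weight α * ∏ j, t j ^ α j := by
          refine Finset.sum_le_sum_of_subset_of_nonneg (fun α hα => ?_) fun α _ _ => hterm α
          simp only [Finset.mem_biUnion, Finset.mem_piAntidiag]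
          exact ⟨∑ j, α j, Finset.mem_image_of_mem _ hα, rfl, fun _ _ => Finset.mem_univ _⟩
      _ = ∑ m ∈ D, (∑ j, t j) ^ m := by
          rw [Finset.sum_biUnion]
          · exact Finset.sum_congr rfl fun m _ => sum_weight_degree t m
          · intro a _ b _ hab
            refine Finset.disjoint_left.2 fun α ha hb => hab ?_
            rw [← (Finset.mem_piAntidiag.1 ha).1, (Finset.mem_piAntidiag.1 hb).1]
      _ ≤ ∑' m : ℕ, (∑ j, t j) ^ m :=
          (summable_geometric_of_lt_one hT0 hT).sum_le_tsum _ fun m _ => pow_nonneg hT0 m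
  have hf : Summable fun α => ‖f α‖ ^ 2 := by
    have := (lp.memℓp f).summable (by norm_num)
    simpa using this
  refine Summable.of_norm_bounded (hf.add hw) fun α => ?_
  have e1 : ‖∏ j, (z : EuclideanSpace ℂ (Fin d)) j ^ α j‖ ^ 2 = ∏ j, t j ^ α j := by
    rw [norm_prod, ← Finset.prod_pow]
    refine Finset.prod_congr rfl fun j _ => ?_
    rw [norm_pow, ht, ← pow_mul, ← pow_mul, mul_comm]
  rw [norm_mul, norm_mul, Complex.norm_real, Real.norm_of_nonneg (Real.sqrt_nonneg _), ← e1]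
  have e2 := Real.sq_sqrt (weight_pos α).le
  nlinarith [sq_nonneg (‖f α‖ - √(weight α) * ‖∏ j, (z : EuclideanSpace ℂ (Fin d)) j ^ α j‖),
    sq_nonneg ‖f α‖, hterm α]

/-! ### Multiplication operators -/

/-- Adding `1` to the `j`-th entry of a multi-index. -/
def incr {d : ℕ} (j : Fin d) (α : Fin d → ℕ) : Fin d → ℕ := α + Pi.single j 1

lemma incr_injective {d : ℕ} (j : Fin d) : Function.Injective (incr j) :=
  fun _ _ h => add_right_cancel h

lemma weight_incr {d : ℕ} (j : Fin d) (α : Fin d → ℕ) :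
    weight (incr j α) = weight α * (((∑ i, α i : ℕ) + 1 : ℝ) / ((α j : ℝ) + 1)) := by
  have h1 : ∑ i, incr j α i = (∑ i, α i) + 1 := by simp [incr, Finset.sum_add_distrib]
  have h2 : ∏ i, (incr j α i).factorial = (α j + 1) * ∏ i, (α i).factorial := by
    rw [← Finset.mul_prod_erase _ _ (Finset.mem_univ j),
      ← Finset.mul_prod_erase _ (fun i => (α i).factorial) (Finset.mem_univ j), ← mul_assoc]
    congr 1
    · simp [incr, Nat.factorial_succ]
    · refine Finset.prod_congr rfl fun i hi => ?_
      simp [incr, Finset.ne_of_mem_erase hi]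
  have h3 : ((∏ i, (α i).factorial : ℕ) : ℝ) ≠ 0 := by
    exact_mod_cast (Finset.prod_pos fun i _ => Nat.factorial_pos _).ne'
  rw [weight, weight, h1, h2, Nat.factorial_succ]
  push_cast at h3 ⊢
  field_simp

/-- The coordinates of `z_j f`: since `z_j z^β = z^{β + e_j}` and
`‖z^{β + e_j}‖² / ‖z^β‖² = (β_j + 1) / (|β| + 1)`, the coordinate at `α` is
`√(α_j / |α|) f_{α - e_j}`, and it is `0` if `α_j = 0`. -/
def shiftCoord {d : ℕ} (j : Fin d) (f : (Fin d → ℕ) → ℂ) (α : Fin d → ℕ) : ℂ :=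
  (√((α j : ℝ) / ((∑ i, α i : ℕ) : ℝ)) : ℂ) * f (α - Pi.single j 1)

lemma mem_range_incr {d : ℕ} (j : Fin d) {α : Fin d → ℕ} (h : α j ≠ 0) :
    α ∈ Set.range (incr j) := by
  refine ⟨α - Pi.single j 1, ?_⟩
  ext i
  by_cases hi : i = j
  · subst hi; simp [incr]; omega
  · simp [incr, hi]

lemma shiftCoord_eq_zero {d : ℕ} (j : Fin d) (f : (Fin d → ℕ) → ℂ) {α : Fin d → ℕ}
    (h : α ∉ Set.range (incr j)) : shiftCoord j f α = 0 := by
  have : α j = 0 := by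
    by_contra h0
    exact h (mem_range_incr j h0)
  simp [shiftCoord, this]

lemma shiftCoord_incr {d : ℕ} (j : Fin d) (f : (Fin d → ℕ) → ℂ) (α : Fin d → ℕ) :
    shiftCoord j f (incr j α) = (√(((α j : ℝ) + 1) / ((∑ i, α i : ℕ) + 1 : ℝ)) : ℂ) * f α := by
  have h1 : incr j α - Pi.single j 1 = α := by simp [incr]
  have h2 : ∑ i, incr j α i = (∑ i, α i) + 1 := by simp [incr, Finset.sum_add_distrib]
  rw [shiftCoord, h1, h2]
  simp [incr]

lemma norm_shiftCoord_incr_le {d : ℕ} (j : Fin d) (f : (Fin d → ℕ) → ℂ) (α : Fin d → ℕ) :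
    ‖shiftCoord j f (incr j α)‖ ≤ ‖f α‖ := by
  rw [shiftCoord_incr, norm_mul]
  refine mul_le_of_le_one_left (norm_nonneg _) ?_
  rw [Complex.norm_real, Real.norm_of_nonneg (Real.sqrt_nonneg _), Real.sqrt_le_one]
  refine div_le_one_of_le₀ ?_ (by positivity)
  have : α j ≤ ∑ i, α i := Finset.single_le_sum (fun i _ => Nat.zero_le _) (Finset.mem_univ j)
  exact_mod_cast Nat.succ_le_succ this

lemma hasSum_shiftCoord {d : ℕ} (j : Fin d) (f : DASpace d) :
    Summable (fun α => ‖shiftCoord j f α‖ ^ 2) ∧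
      ∑' α, ‖shiftCoord j f α‖ ^ 2 ≤ ∑' α, ‖f α‖ ^ 2 := by
  have hf : Summable fun α => ‖f α‖ ^ 2 := by
    have := (lp.memℓp f).summable (by norm_num)
    simpa using this
  have h0 : ∀ α ∉ Set.range (incr j), ‖shiftCoord j f α‖ ^ 2 = 0 := fun α h => by
    simp [shiftCoord_eq_zero j f h]
  have hle : ∀ α, ‖shiftCoord j f (incr j α)‖ ^ 2 ≤ ‖f α‖ ^ 2 := fun α =>
    pow_le_pow_left₀ (norm_nonneg _) (norm_shiftCoord_incr_le j f α) 2
  have hs : Summable fun α => ‖shiftCoord j f (incr j α)‖ ^ 2 :=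
    Summable.of_nonneg_of_le (fun _ => by positivity) hle hf
  refine ⟨((incr_injective j).summable_iff h0).1 hs, ?_⟩
  have hsup : Function.support (fun α => ‖shiftCoord j f α‖ ^ 2) ⊆ Set.range (incr j) := by
    intro α hα
    by_contra h
    exact hα (h0 α h)
  rw [← (incr_injective j).tsum_eq hsup]
  exact hs.tsum_le_tsum hle hf

/-- The operator `M_{z_j}` of multiplication by the `j`-th coordinate, see `evalAt_coordMul`. -/
def coordMul {d : ℕ} (j : Fin d) : DASpace d →L[ℂ] DASpace d :=
  LinearMap.mkContinuous
    { toFun := fun f => ⟨shiftCoord j f, memℓp_gen (by simpa using (hasSum_shiftCoord j f).1)⟩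
      map_add' := fun f g => by
        ext α
        exact mul_add _ _ _
      map_smul' := fun c f => by
        ext α
        exact mul_left_comm _ _ _ } 1
    (fun f => by
      rw [one_mul]
      refine le_of_sq_le_sq ?_ (norm_nonneg _)
      have h := (hasSum_shiftCoord j f).2
      have e : ∀ g : DASpace d, ‖g‖ ^ 2 = ∑' α, ‖g α‖ ^ 2 := fun g => by
        have := lp.norm_rpow_eq_tsum (p := 2) (by norm_num) g
        simpa using this
      rw [e, e]
      exact h)

lemma evalAt_coordMul {d : ℕ} (j : Fin d) (f : DASpace d) (z : Ball d) :
    evalAt (coordMul j f) z = (z : EuclideanSpace ℂ (Fin d)) j * evalAt f z := by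
  unfold evalAt
  have hsup : Function.support (fun α : Fin d → ℕ => coordMul j f α * (√(weight α) : ℂ) *
      ∏ i, (z : EuclideanSpace ℂ (Fin d)) i ^ α i) ⊆ Set.range (incr j) := by
    intro α hα
    by_contra h
    refine hα ?_
    have h0 : coordMul j f α = 0 := shiftCoord_eq_zero j f h
    simp only [h0, zero_mul]
  rw [← (incr_injective j).tsum_eq hsup, ← tsum_mul_left]
  refine tsum_congr fun α => ?_
  have h1 : coordMul j f (incr j α) = _ := shiftCoord_incr j f α
  have h2 : √(((α j : ℝ) + 1) / ((∑ i, α i : ℕ) + 1 : ℝ)) * √(weight (incr j α))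
      = √(weight α) := by
    rw [← Real.sqrt_mul (by positivity), weight_incr]
    congr 1
    field_simp
  have h3 : ∏ i, (z : EuclideanSpace ℂ (Fin d)) i ^ incr j α i =
      (z : EuclideanSpace ℂ (Fin d)) j * ∏ i, (z : EuclideanSpace ℂ (Fin d)) i ^ α i := by
    simp only [incr, Pi.add_apply, pow_add, Finset.prod_mul_distrib]
    rw [mul_comm, Finset.prod_eq_single j (fun i _ hi => by simp [hi]) (by simp)]
    simp
  rw [h1, h3, ← h2, Complex.ofReal_mul]
  ring

/-- The multiplier algebra, as an algebra of operators: all bounded operators `M_φ` of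
multiplication by a function `φ` on the ball. (If `φ g` is in the Drury–Arveson space for all `g`
in it, then `M_φ` is bounded by the closed graph theorem.) -/
def multiplierOperators (d : ℕ) : Set (DASpace d →L[ℂ] DASpace d) :=
  {T | ∃ φ : Ball d → ℂ, ∀ (g : DASpace d) (z : Ball d), evalAt (T g) z = φ z * evalAt g z}

/-! ### The Grassmannian of coinvariant subspaces -/

open ContinuousLinearMap in
/-- The orthogonal projections onto the `n`-dimensional multiplier-coinvariant subspaces,
with the topology of the operator norm. -/
def coinvariantProjections (d n : ℕ) : Set (DASpace d →L[ℂ] DASpace d) :=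
  {P | P ∘L P = P ∧ adjoint P = P ∧
    (∀ M ∈ multiplierOperators d, P ∘L adjoint M ∘L P = adjoint M ∘L P) ∧
    FiniteDimensional ℂ (LinearMap.range (P : DASpace d →ₗ[ℂ] DASpace d)) ∧
    Module.finrank ℂ (LinearMap.range (P : DASpace d →ₗ[ℂ] DASpace d)) = n}

/-- The compressed shift `P M_z|_{P H}`, a `d`-tuple of endomorphisms of the range of `P`. -/
def compressedShift {d : ℕ} (P : DASpace d →L[ℂ] DASpace d) (j : Fin d) :
    Module.End ℂ (LinearMap.range (P : DASpace d →ₗ[ℂ] DASpace d)) :=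
  (P : DASpace d →ₗ[ℂ] DASpace d).rangeRestrict ∘ₗ
    (coordMul j : DASpace d →ₗ[ℂ] DASpace d) ∘ₗ
      (LinearMap.range (P : DASpace d →ₗ[ℂ] DASpace d)).subtype

end DruryArveson

end

noncomputable section

namespace DruryArveson

/-! ### Tuples of points and their multiplicities -/

/-! A commuting tuple `A` on an `n`-dimensional space splits it into joint generalized eigenspaces.
Listing joint eigenvalues with multiplicity gives points x_1, …, x_n with det(t - ∑ c_j A_j) = ∏ (t
- ∑ c_j x_ij) for all c and t (`exists_spectral_tuple`). These polynomials determine the points up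
to order (`card_fiber_eq_of_forall_prod_eq`), so spectra can be compared through determinants.

The points lie in the open ball because the row (M_{z_1}, …, M_{z_d}) satisfies ∑ ‖M_{z_j}^* f‖² =
‖f‖² - |f_0|². A compressed eigenvector with eigenvalue outside the ball would have f_0 = 0 and be a
joint eigenvector of the adjoints, hence vanish (`norm_lt_one_of_inner_coordMul`).

Surjectivity: at a point of multiplicity m, the reproducing kernel and its first m - 1 derivatives
in one fixed coordinate direction span an m-dimensional space. It is a joint kernel of polynomials
in the M_{z_j}^*, so it is invariant under every adjoint multiplier. The sum of these spaces has
dimension at most n, and each prescribed point occurs with at least the prescribed multiplicity.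
Counting forces equality (`exists_projection_of_tuple`).

Continuity: pairing with a fixed tuple of vectors turns the determinant on the varying space P H
into an identity between norm-continuous functions of P (`compressionDet_eq`). If projections
converge, the spectra subconverge in the compact closed polyball, and the limit has the same
polynomials as the limit spectrum. It is therefore a reordering of that spectrum and lies in the
open ball, where the pseudohyperbolic distance tends to 0 (`exists_subseq_phDist_lt`). -/

lemma exists_perm_of_card_fiber_eq {n : ℕ} {β : Type*} (x y : Fin n → β)
    (h : ∀ b, Nat.card {i // x i = b} = Nat.card {i // y i = b}) :
    ∃ s : Equiv.Perm (Fin n), y = x ∘ s := by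
  have e : ∀ b, {i // y i = b} ≃ {i // x i = b} := fun b => (Finite.card_eq.1 (h b).symm).some
  refine ⟨((Equiv.sigmaFiberEquiv y).symm.trans (Equiv.sigmaCongrRight e)).trans
    (Equiv.sigmaFiberEquiv x), funext fun i => ?_⟩
  exact ((e (y i)) ⟨i, rfl⟩).2.symm

/-- Each condition excludes a proper hyperplane of coefficients, and finitely many of these do not
cover ℂ^d. -/
lemma exists_separating_coeffs {d : ℕ} {ι : Type*} [Finite ι]
    (v : ι → EuclideanSpace ℂ (Fin d)) (hv : ∀ i, v i ≠ 0) :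
    ∃ c : Fin d → ℂ, ∀ i, ∑ j, c j * v i j ≠ 0 := by
  obtain ⟨c, hc⟩ := Module.Dual.exists_forall_ne_zero_of_forall_exists
    (fun i => ∑ j, v i j • (LinearMap.proj j : (Fin d → ℂ) →ₗ[ℂ] ℂ)) (fun i => by
      obtain ⟨j, hj⟩ : ∃ j, v i j ≠ 0 := by
        by_contra! h
        exact hv i (by ext j; exact h j)
      refine ⟨Pi.single j 1, ?_⟩
      simpa [LinearMap.sum_apply, Pi.single_apply] using hj)
  refine ⟨c, fun i => ?_⟩
  have := hc i
  simpa [LinearMap.sum_apply, mul_comm] using this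

lemma card_fiber_eq_of_prod_eq {n : ℕ} (a b : Fin n → ℂ)
    (h : ∀ t : ℂ, ∏ i, (t - a i) = ∏ i, (t - b i)) (r : ℂ) :
    Nat.card {i // a i = r} = Nat.card {i // b i = r} := by
  classical
  have key : ∀ a : Fin n → ℂ, Nat.card {i // a i = r} =
      (∏ i, (Polynomial.X - Polynomial.C (a i))).roots.count r := by
    intro a
    have : (∏ i, (Polynomial.X - Polynomial.C (a i))) =
        ((Finset.univ.val.map a).map fun t => Polynomial.X - Polynomial.C t).prod := by
      rw [Multiset.map_map]
      rfl
    rw [this, Polynomial.roots_multiset_prod_X_sub_C, Multiset.count_map, Nat.card_eq_fintype_card,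
      Fintype.card_subtype, ← Finset.filter_val, Finset.card_val]
    congr 1
    ext i
    simp [eq_comm]
  rw [key, key]
  congr 2
  refine Polynomial.funext fun t => ?_
  simpa [Polynomial.eval_prod] using h t

/-- A tuple of points of `ℂ^d` is determined up to order by the products
`∏ i, (t - ∑ j, c j * x i j)`. -/
lemma card_fiber_eq_of_forall_prod_eq {d n : ℕ} (x y : Fin n → EuclideanSpace ℂ (Fin d))
    (h : ∀ (c : Fin d → ℂ) (t : ℂ),
      ∏ i, (t - ∑ j, c j * x i j) = ∏ i, (t - ∑ j, c j * y i j))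
    (l : EuclideanSpace ℂ (Fin d)) :
    Nat.card {i // x i = l} = Nat.card {i // y i = l} := by
  -- One functional separates `l` from every other point of both tuples, so the fibre over `l`
  -- becomes a fibre of scalars.
  obtain ⟨c, hc⟩ := exists_separating_coeffs
    (fun i : {i : Fin n ⊕ Fin n // Sum.elim x y i ≠ l} => Sum.elim x y i.1 - l)
    (fun i => sub_ne_zero.2 i.2)
  have hsep : ∀ i, ∑ j, c j * Sum.elim x y i j = ∑ j, c j * l j ↔ Sum.elim x y i = l := by
    intro i
    refine ⟨fun hi => ?_, fun hi => by rw [hi]⟩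
    by_contra hne
    refine hc ⟨i, hne⟩ ?_
    simp only [PiLp.sub_apply, mul_sub, Finset.sum_sub_distrib]
    exact sub_eq_zero.2 hi
  have key := card_fiber_eq_of_prod_eq _ _ (h c) (∑ j, c j * l j)
  have hx : ∀ i, ∑ j, c j * x i j = ∑ j, c j * l j ↔ x i = l := fun i => hsep (Sum.inl i)
  have hy : ∀ i, ∑ j, c j * y i j = ∑ j, c j * l j ↔ y i = l := fun i => hsep (Sum.inr i)
  simpa only [hx, hy] using key

/-! ### Determinants and direct sums -/

lemma det_eq_prod_det_restrict {ι V : Type*} [Fintype ι] [DecidableEq ι] [AddCommGroup V]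
    [Module ℂ V] [FiniteDimensional ℂ V] {N : ι → Submodule ℂ V} (h : DirectSum.IsInternal N)
    {f : Module.End ℂ V} (hf : ∀ i, ∀ v ∈ N i, f v ∈ N i) :
    LinearMap.det f = ∏ i, LinearMap.det (f.restrict (hf i)) := by
  classical
  -- The order is arbitrary; it only serves the block-triangular determinant formula.
  let _ : LinearOrder ι := LinearOrder.lift' (Fintype.equivFin ι) (Fintype.equivFin ι).injective
  let b : (i : ι) → Module.Basis _ ℂ (N i) := fun i => Module.Free.chooseBasis ℂ (N i)
  rw [← LinearMap.det_toMatrix (h.collectedBasis b),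
    LinearMap.toMatrix_directSum_collectedBasis_eq_blockDiagonal' h h b b hf,
    Matrix.BlockTriangular.det_fintype (Matrix.blockTriangular_blockDiagonal' _)]
  refine Finset.prod_congr rfl fun k _ => ?_
  rw [← LinearMap.det_toMatrix (b k),
    ← Matrix.det_submatrix_equiv_self (Equiv.sigmaSubtype k).symm]
  congr 1
  ext p q
  simp [Matrix.toSquareBlock_def, Matrix.blockDiagonal'_apply, Equiv.sigmaSubtype]

lemma det_smul_one_sub_of_isNilpotent {V : Type*} [AddCommGroup V] [Module ℂ V]
    [FiniteDimensional ℂ V] (N : Module.End ℂ V) (hN : IsNilpotent N) (s : ℂ) :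
    LinearMap.det (s • (1 : Module.End ℂ V) - N) = s ^ Module.finrank ℂ V := by
  have h := (LinearMap.charpoly_eq_X_pow_iff N).2 fun m => by
    obtain ⟨k, hk⟩ := hN
    exact ⟨k, by rw [hk]; rfl⟩
  have h2 := LinearMap.eval_charpoly N s
  rw [h, Polynomial.eval_pow, Polynomial.eval_X] at h2
  rw [h2]
  rfl

/-! ### Commuting tuples of endomorphisms -/

section Commuting

variable {d : ℕ} {V : Type*} [AddCommGroup V] [Module ℂ V]

/-- The joint generalized eigenspace of a tuple. -/
def jointGenEigenspace (A : Fin d → Module.End ℂ V) (l : Fin d → ℂ) : Submodule ℂ V :=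
  ⨅ j, (A j).maxGenEigenspace (l j)

lemma mem_jointGenEigenspace {A : Fin d → Module.End ℂ V} {l : Fin d → ℂ} {v : V} :
    v ∈ jointGenEigenspace A l ↔ ∀ j, ∃ k : ℕ, ((A j - l j • (1 : Module.End ℂ V)) ^ k) v = 0 := by
  simp [jointGenEigenspace, Module.End.mem_maxGenEigenspace]

lemma mapsTo_jointGenEigenspace {A : Fin d → Module.End ℂ V} {B : Module.End ℂ V}
    (hB : ∀ j, Commute (A j) B) (l : Fin d → ℂ) :
    ∀ v ∈ jointGenEigenspace A l, B v ∈ jointGenEigenspace A l := by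
  intro v hv
  simp only [jointGenEigenspace, Submodule.mem_iInf] at hv ⊢
  exact fun j => Module.End.mapsTo_maxGenEigenspace_of_comm (hB j) _ (hv j)

/-- Writing the power as a word of length |α| permits induction one factor at a time. -/
lemma tuplePow_eq_list_prod (N : Fin d → Module.End ℂ V) (α : Fin d → ℕ) :
    ∃ L : List (Fin d), L.length = ∑ j, α j ∧ tuplePow N α = (L.map N).prod := by
  refine ⟨(List.ofFn fun j => List.replicate (α j) j).flatten, ?_, ?_⟩
  · simp [List.length_flatten, List.map_ofFn, Function.comp_def, List.sum_ofFn]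
  · simp [tuplePow, List.map_flatten, List.prod_flatten, List.map_ofFn, Function.comp_def]

lemma tuplePow_single (N : Fin d → Module.End ℂ V) (j : Fin d) (m : ℕ) :
    tuplePow N (Pi.single j m) = N j ^ m := by
  have : (fun i => N i ^ (Pi.single j m : Fin d → ℕ) i) = Pi.mulSingle j (N j ^ m) := by
    ext i : 1
    by_cases h : i = j
    · subst h; simp
    · simp [h]
  have hnd : (List.finRange d).Nodup := List.nodup_finRange d
  rw [tuplePow, this, List.ofFn_eq_map]
  rw [List.prod_map_eq_pow_single j]
  · rw [List.count_eq_one_of_mem hnd (List.mem_finRange j)]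
    simp
  · intro i hi _
    simp [hi]

lemma commute_sub_smul_one {B C : Module.End ℂ V} (h : Commute B C) (s t : ℂ) :
    Commute (B - s • (1 : Module.End ℂ V)) (C - t • (1 : Module.End ℂ V)) :=
  ((h.sub_left (Commute.one_left _ |>.smul_left s)).sub_right
    ((Commute.one_right _).smul_right t))

lemma mem_jointSpectrum_iff_exists {A : Fin d → Module.End ℂ V} {l : EuclideanSpace ℂ (Fin d)} :
    l ∈ jointSpectrum A ↔ ∃ v, v ≠ 0 ∧ ∀ j, A j v = l j • v := by
  rw [jointSpectrum, Set.mem_ofPred_eq, Submodule.ne_bot_iff]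
  simp [Submodule.mem_iInf, sub_eq_zero, and_comm]

lemma commute_smul_one_sub_sum {A : Fin d → Module.End ℂ V} (hA : ∀ i j, Commute (A i) (A j)) (c : Fin d → ℂ) (t : ℂ)
    (i : Fin d) : Commute (A i) (t • (1 : Module.End ℂ V) - ∑ j, c j • A j) :=
  ((Commute.one_right _).smul_right t).sub_right
    (Commute.sum_right _ _ _ fun j _ => (hA i j).smul_right _)

variable [FiniteDimensional ℂ V]

lemma pow_finrank_apply_eq_zero (N : Module.End ℂ V) {v : V} (h : ∃ k : ℕ, (N ^ k) v = 0) :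
    (N ^ Module.finrank ℂ V) v = 0 := by
  have hv : v ∈ N.maxGenEigenspace 0 := by simpa [Module.End.mem_maxGenEigenspace] using h
  rw [Module.End.maxGenEigenspace_eq_genEigenspace_finrank, Module.End.mem_genEigenspace_nat] at hv
  simpa using hv

/-- If N U = U, then N^k U = U for all k, whereas N^(dim V) kills U. -/
lemma finrank_map_lt_of_nilpotent {N : Module.End ℂ V} {U : Submodule ℂ V} (hU : U ≠ ⊥)
    (hm : ∀ u ∈ U, N u ∈ U) (hn : ∀ u ∈ U, ∃ k : ℕ, (N ^ k) u = 0) :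
    Module.finrank ℂ (U.map N) < Module.finrank ℂ U := by
  have hle : U.map N ≤ U := by
    rintro _ ⟨u, hu, rfl⟩
    exact hm u hu
  refine Submodule.finrank_lt_finrank_of_lt (lt_of_le_of_ne hle fun heq => hU ?_)
  have hpow : ∀ k : ℕ, U.map (N ^ k) = U := by
    intro k
    induction k with
    | zero => exact Submodule.map_id U
    | succ k ih =>
      rw [pow_succ', Module.End.mul_eq_comp, Submodule.map_comp, ih, heq]
  rw [← hpow (Module.finrank ℂ V), eq_bot_iff]
  rintro _ ⟨u, hu, rfl⟩
  exact pow_finrank_apply_eq_zero N (hn u hu)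

/-- Products of commuting endomorphisms that are nilpotent on `U` strictly shrink `U`. -/
lemma map_list_prod_eq_bot_or {N : Fin d → Module.End ℂ V} (hN : ∀ i j, Commute (N i) (N j))
    {U : Submodule ℂ V} (hm : ∀ j, ∀ u ∈ U, N j u ∈ U)
    (hn : ∀ j, ∀ u ∈ U, ∃ k : ℕ, (N j ^ k) u = 0) (L : List (Fin d)) :
    U.map (L.map N).prod = ⊥ ∨
      Module.finrank ℂ (U.map (L.map N).prod) + L.length ≤ Module.finrank ℂ U := by
  have hsub : ∀ L : List (Fin d), ∀ u ∈ U, (L.map N).prod u ∈ U := by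
    intro L
    induction L with
    | nil => simp
    | cons a L ih =>
      intro u hu
      simpa using hm a _ (ih u hu)
  induction L with
  | nil =>
    right
    rw [List.map_nil, List.prod_nil, Module.End.one_eq_id, Submodule.map_id]
    simp
  | cons a L ih =>
    have hcomp : U.map ((a :: L).map N).prod = (U.map (L.map N).prod).map (N a) := by
      rw [List.map_cons, List.prod_cons, Module.End.mul_eq_comp, Submodule.map_comp]
    rw [hcomp]
    by_cases hbot : U.map (L.map N).prod = ⊥
    · left
      rw [hbot, Submodule.map_bot]
    · right
      have h1 := ih.resolve_left hbot
      have h2 := finrank_map_lt_of_nilpotent (N := N a) hbot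
        (by
          rintro _ ⟨u, hu, rfl⟩
          refine ⟨N a u, hm a u hu, ?_⟩
          have : Commute (L.map N).prod (N a) := by
            refine (Commute.list_prod_right _ _ fun x hx => ?_).symm
            obtain ⟨j, -, rfl⟩ := List.mem_map.1 hx
            exact hN a j
          exact LinearMap.congr_fun this.eq u)
        (by
          rintro _ ⟨u, hu, rfl⟩
          exact hn a _ (hsub L u hu))
      rw [List.length_cons]
      omega

/-- While some `N j` is nonzero on U, pass to its image, which is smaller and still invariant. When
all vanish, any nonzero vector works. -/
lemma exists_common_kernel {N : Fin d → Module.End ℂ V} (hN : ∀ i j, Commute (N i) (N j))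
    {U : Submodule ℂ V} (hU : U ≠ ⊥) (hm : ∀ j, ∀ u ∈ U, N j u ∈ U)
    (hn : ∀ j, ∀ u ∈ U, ∃ k : ℕ, (N j ^ k) u = 0) :
    ∃ u ∈ U, u ≠ 0 ∧ ∀ j, N j u = 0 := by
  induction hk : Module.finrank ℂ U using Nat.strong_induction_on generalizing U with
  | _ k ih =>
    by_cases h : ∃ j, U.map (N j) ≠ ⊥
    · obtain ⟨j, hj⟩ := h
      have hlt := finrank_map_lt_of_nilpotent hU (hm j) (hn j)
      obtain ⟨u, hu, hu0, hall⟩ := ih _ (hk ▸ hlt) (U := U.map (N j)) hj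
        (by
          rintro i _ ⟨u, hu, rfl⟩
          exact ⟨N i u, hm i u hu, LinearMap.congr_fun (hN j i).eq u⟩)
        (by
          rintro i _ ⟨u, hu, rfl⟩
          exact hn i _ (hm j u hu)) rfl
      obtain ⟨w, hw, rfl⟩ := hu
      exact ⟨_, hm j w hw, hu0, hall⟩
    · push Not at h
      obtain ⟨u, hu, hu0⟩ := Submodule.exists_mem_ne_zero_of_ne_bot hU
      refine ⟨u, hu, hu0, fun j => ?_⟩
      have : N j u ∈ U.map (N j) := ⟨u, hu, rfl⟩
      rwa [h j, Submodule.mem_bot] at this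

variable {A : Fin d → Module.End ℂ V}

/-- Total degree dim V suffices: each factor of a word strictly lowers the dimension of the image
until it is zero. Conversely, the multi-indices concentrated at one j give each generalized
eigenspace. -/
lemma rootSubspace_eq_jointGenEigenspace (hA : ∀ i j, Commute (A i) (A j))
    (l : EuclideanSpace ℂ (Fin d)) : rootSubspace A l = jointGenEigenspace A l := by
  apply le_antisymm
  · intro v hv
    rw [mem_jointGenEigenspace]
    intro j
    refine ⟨Module.finrank ℂ V, ?_⟩
    rw [rootSubspace, Submodule.mem_iInf] at hv
    have := hv ⟨Pi.single j (Module.finrank ℂ V), by simp⟩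
    rwa [LinearMap.mem_ker, tuplePow_single] at this
  · intro v hv
    rw [rootSubspace, Submodule.mem_iInf]
    rintro ⟨α, hα⟩
    obtain ⟨L, hL, hprod⟩ := tuplePow_eq_list_prod
      (fun j => A j - l j • (1 : Module.End ℂ V)) α
    have hcase := map_list_prod_eq_bot_or (N := fun j => A j - l j • (1 : Module.End ℂ V))
      (fun i j => commute_sub_smul_one (hA i j) _ _) (U := jointGenEigenspace A l)
      (fun j u hu => mapsTo_jointGenEigenspace (fun i => by
        simpa using commute_sub_smul_one (hA i j) 0 (l j)) l _ hu)
      (fun j u hu => mem_jointGenEigenspace.1 hu j) L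
    rw [← hprod] at hcase
    have hbot : (jointGenEigenspace A l).map
        (tuplePow (fun j => A j - l j • (1 : Module.End ℂ V)) α) = ⊥ := by
      refine hcase.elim id fun h => ?_
      have := Submodule.finrank_le (jointGenEigenspace A l)
      rw [hL, hα] at h
      exact Submodule.finrank_eq_zero.1 (by omega)
    have : tuplePow (fun j => A j - l j • (1 : Module.End ℂ V)) α v ∈
        (jointGenEigenspace A l).map
          (tuplePow (fun j => A j - l j • (1 : Module.End ℂ V)) α) := ⟨v, hv, rfl⟩
    rwa [hbot] at this

/-- Off the joint spectrum both sides are 0, since a nonzero joint generalized eigenspace contains a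
joint eigenvector. -/
lemma jointSpectrumMult_eq_finrank (hA : ∀ i j, Commute (A i) (A j))
    (l : EuclideanSpace ℂ (Fin d)) :
    jointSpectrumMult A l = Module.finrank ℂ (jointGenEigenspace A l) := by
  rw [jointSpectrumMult, rootSubspace_eq_jointGenEigenspace hA]
  split_ifs with h
  · rfl
  · symm
    rw [Submodule.finrank_eq_zero]
    by_contra hU
    obtain ⟨u, -, hu0, hu⟩ := exists_common_kernel
      (N := fun j => A j - l j • (1 : Module.End ℂ V))
      (fun i j => commute_sub_smul_one (hA i j) _ _) hU
      (fun j u hu => mapsTo_jointGenEigenspace (fun i => by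
        simpa using commute_sub_smul_one (hA i j) 0 (l j)) l _ hu)
      (fun j u hu => mem_jointGenEigenspace.1 hu j)
    exact h (mem_jointSpectrum_iff_exists.2 ⟨u, hu0, fun j => by
      simpa [sub_eq_zero] using hu j⟩)

/-- Here the operator is the scalar t - ∑ c_j l_j minus a combination of commuting nilpotents, which
is again nilpotent. -/
lemma det_restrict_jointGenEigenspace (hA : ∀ i j, Commute (A i) (A j)) (l : Fin d → ℂ)
    (c : Fin d → ℂ) (t : ℂ) :
    LinearMap.det ((t • (1 : Module.End ℂ V) - ∑ j, c j • A j).restrict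
      (mapsTo_jointGenEigenspace (commute_smul_one_sub_sum hA c t) l)) =
      (t - ∑ j, c j * l j) ^ Module.finrank ℂ (jointGenEigenspace A l) := by
  have hmaps : ∀ j, ∀ v ∈ jointGenEigenspace A l,
      (A j - l j • (1 : Module.End ℂ V)) v ∈ jointGenEigenspace A l := fun j => mapsTo_jointGenEigenspace (fun i => by
        simpa using commute_sub_smul_one (hA i j) 0 (l j)) l
  let N : Fin d → Module.End ℂ (jointGenEigenspace A l) := fun j =>
    (A j - l j • (1 : Module.End ℂ V)).restrict (hmaps j)
  have hNnil : ∀ j, IsNilpotent (N j) := by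
    intro j
    refine ⟨Module.finrank ℂ V, ?_⟩
    ext v
    simp only [N]
    rw [Module.End.pow_restrict]
    simpa using pow_finrank_apply_eq_zero _ (mem_jointGenEigenspace.1 v.2 j)
  have hNcomm : ∀ i j, Commute (N i) (N j) := by
    intro i j
    ext v
    exact LinearMap.congr_fun (commute_sub_smul_one (hA i j) (l i) (l j)).eq v
  have hsum : IsNilpotent (∑ j, c j • N j) :=
    Commute.isNilpotent_sum (fun j _ => (hNnil j).smul _)
      (fun i j _ _ => ((hNcomm i j).smul_left _).smul_right _)
  rw [← det_smul_one_sub_of_isNilpotent _ hsum]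
  congr 1
  ext v
  simp only [LinearMap.coe_restrict_apply, LinearMap.sub_apply, LinearMap.smul_apply,
    Module.End.one_apply, LinearMap.sum_apply, Submodule.coe_sub, Submodule.coe_smul,
    Submodule.coe_sum, N, smul_sub, Finset.sum_sub_distrib, sub_smul, Finset.sum_smul, mul_smul]
  abel

/-- The joint spectrum with multiplicities of a commuting tuple on an `n`-dimensional space is
given by `n` points, and these are the roots of the determinants of the linear combinations. -/
theorem exists_spectral_tuple {n : ℕ} (hA : ∀ i j, Commute (A i) (A j))
    (hn : Module.finrank ℂ V = n) :
    ∃ x : Fin n → EuclideanSpace ℂ (Fin d),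
      (∀ l, Nat.card {i // x i = l} = jointSpectrumMult A l) ∧
      ∀ (c : Fin d → ℂ) (t : ℂ), LinearMap.det (t • (1 : Module.End ℂ V) - ∑ j, c j • A j) =
        ∏ i, (t - ∑ j, c j * x i j) := by
  classical
  have hmaps : ∀ i j φ, Set.MapsTo (A i) ((A j).maxGenEigenspace φ) ((A j).maxGenEigenspace φ) :=
    fun i j φ => Module.End.mapsTo_maxGenEigenspace_of_comm (hA j i) φ
  have hind : iSupIndep (jointGenEigenspace A) :=
    Module.End.independent_iInf_maxGenEigenspace_of_forall_mapsTo A hmaps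
  have htop : ⨆ l, jointGenEigenspace A l = ⊤ :=
    Module.End.iSup_iInf_maxGenEigenspace_eq_top_of_forall_mapsTo A hmaps
      fun i => Module.End.iSup_maxGenEigenspace_eq_top (A i)
  have hint := DirectSum.isInternal_submodule_of_iSupIndep_of_iSup_eq_top hind htop
  have hfin : {l | jointGenEigenspace A l ≠ ⊥}.Finite := WellFoundedGT.finite_ne_bot_of_iSupIndep hind
  let _ : Fintype {l // jointGenEigenspace A l ≠ ⊥} := hfin.fintype
  have hint' := DirectSum.isInternal_ne_bot_iff.2 hint
  let b := hint'.collectedBasis fun l => Module.finBasis ℂ (jointGenEigenspace A l.1)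
  have hcard : Fintype.card (Σ l : {l // jointGenEigenspace A l ≠ ⊥},
      Fin (Module.finrank ℂ (jointGenEigenspace A l.1))) = Fintype.card (Fin n) := by
    rw [← Module.finrank_eq_card_basis b, hn, Fintype.card_fin]
  -- The n points arise by labelling each vector of an adapted basis with its joint eigenvalue.
  let e := Fintype.equivOfCardEq hcard
  refine ⟨fun i => WithLp.toLp 2 (e.symm i).1.1, fun l => ?_, fun c t => ?_⟩
  · rw [jointSpectrumMult_eq_finrank hA]
    have h1 : Nat.card {i // (WithLp.toLp 2 (e.symm i).1.1 : EuclideanSpace ℂ (Fin d)) = l} =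
        Nat.card {p : (Σ l : {l // jointGenEigenspace A l ≠ ⊥},
          Fin (Module.finrank ℂ (jointGenEigenspace A l.1))) // p.1.1 = l} := by
      refine Nat.card_congr (e.symm.subtypeEquiv fun i => ?_)
      constructor
      · intro h; rw [← h]
      · intro h; ext j; simp [h]
    rw [h1]
    by_cases hl : jointGenEigenspace A l = ⊥
    · rw [hl, finrank_bot, Nat.card_eq_zero]
      left
      refine ⟨fun p => p.1.1.2 ?_⟩
      rw [p.2, hl]
    · have h2 : ∀ p : (Σ l : {l // jointGenEigenspace A l ≠ ⊥},
          Fin (Module.finrank ℂ (jointGenEigenspace A l.1))), p.1.1 = l ↔ p.1 = ⟨l, hl⟩ :=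
        fun p => (Subtype.ext_iff (a1 := p.1) (a2 := ⟨l, hl⟩)).symm
      rw [Nat.card_congr (Equiv.subtypeEquivRight h2), Nat.card_congr (Equiv.sigmaSubtype _)]
      simp
  · rw [det_eq_prod_det_restrict hint' (fun l => mapsTo_jointGenEigenspace
      (commute_smul_one_sub_sum hA c t) l.1)]
    rw [e.symm.prod_comp (fun p => t - ∑ j, c j * p.1.1 j), Fintype.prod_sigma]
    refine Finset.prod_congr rfl fun l _ => ?_
    rw [det_restrict_jointGenEigenspace hA]
    simp

end Commuting

open ContinuousLinearMap

/-! ### The adjoints of the coordinate multiplications -/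

lemma coordMul_single {d : ℕ} (j : Fin d) (α : Fin d → ℕ) :
    coordMul j (lp.single 2 α 1) = lp.single 2 (incr j α)
      ((√(((α j : ℝ) + 1) / ((∑ i, α i : ℕ) + 1 : ℝ)) : ℝ) : ℂ) := by
  ext β
  have h : coordMul j (lp.single 2 α 1) β =
      shiftCoord j (lp.single 2 α (1 : ℂ) : DASpace d) β := rfl
  rw [h]
  by_cases hβ : β ∈ Set.range (incr j)
  · obtain ⟨γ, rfl⟩ := hβ
    rw [shiftCoord_incr]
    by_cases hγ : γ = α
    · subst hγ
      rw [lp.single_apply_self, lp.single_apply_self, mul_one]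
    · rw [lp.single_apply_ne _ _ _ hγ,
        lp.single_apply_ne _ _ _ (fun h => hγ (incr_injective j h)), mul_zero]
  · rw [shiftCoord_eq_zero j _ hβ, lp.single_apply_ne]
    rintro rfl
    exact hβ ⟨α, rfl⟩

lemma adjoint_coordMul_apply {d : ℕ} (j : Fin d) (f : DASpace d) (α : Fin d → ℕ) :
    adjoint (coordMul j) f α =
      ((√(((α j : ℝ) + 1) / ((∑ i, α i : ℕ) + 1 : ℝ)) : ℝ) : ℂ) * f (incr j α) := by
  have h := adjoint_inner_right (coordMul j) (lp.single 2 α (1 : ℂ) : DASpace d) f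
  rw [coordMul_single, lp.inner_single_left, lp.inner_single_left] at h
  simpa [mul_comm] using h

lemma norm_sq_eq_tsum {d : ℕ} (f : DASpace d) : ‖f‖ ^ 2 = ∑' α, ‖f α‖ ^ 2 := by
  have := lp.norm_rpow_eq_tsum (p := 2) (by norm_num) f
  simpa using this

lemma summable_norm_sq {d : ℕ} (f : DASpace d) : Summable fun α => ‖f α‖ ^ 2 := by
  have := (lp.memℓp f).summable (by norm_num)
  simpa using this

/-- The weights β_j / |β| sum to 1 over j when β ≠ 0, which yields the row identity. -/
lemma hasSum_norm_sq_adjoint_coordMul {d : ℕ} (j : Fin d) (f : DASpace d) :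
    HasSum (fun β : Fin d → ℕ => ((β j : ℝ) / ((∑ i, β i : ℕ) : ℝ)) * ‖f β‖ ^ 2)
      (‖adjoint (coordMul j) f‖ ^ 2) := by
  have h0 : ∀ β ∉ Set.range (incr j),
      ((β j : ℝ) / ((∑ i, β i : ℕ) : ℝ)) * ‖f β‖ ^ 2 = 0 := by
    intro β hβ
    have : β j = 0 := by
      by_contra h
      exact hβ (mem_range_incr j h)
    simp [this]
  rw [← (incr_injective j).hasSum_iff h0, norm_sq_eq_tsum]
  convert (summable_norm_sq (adjoint (coordMul j) f)).hasSum using 2 with α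
  have h2 : ∑ i, incr j α i = (∑ i, α i) + 1 := by simp [incr, Finset.sum_add_distrib]
  have h3 : incr j α j = α j + 1 := by simp [incr]
  rw [Function.comp_apply, adjoint_coordMul_apply, norm_mul, mul_pow, Complex.norm_real,
    Real.norm_of_nonneg (Real.sqrt_nonneg _), Real.sq_sqrt (by positivity), h2, h3]
  push_cast
  rfl

/-- The row `(M_{z_1}, …, M_{z_d})` is a contraction with defect the projection onto the
constants. -/
lemma sum_norm_sq_adjoint_coordMul {d : ℕ} (f : DASpace d) :
    ∑ j, ‖adjoint (coordMul j) f‖ ^ 2 + ‖f 0‖ ^ 2 = ‖f‖ ^ 2 := by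
  classical
  have hs := hasSum_sum (s := Finset.univ) fun j _ => hasSum_norm_sq_adjoint_coordMul j f
  -- At β = 0 the weights are 0 / 0 = 0, so this term is supplied separately.
  have h0 : HasSum (fun β : Fin d → ℕ => if β = 0 then ‖f 0‖ ^ 2 else 0) (‖f 0‖ ^ 2) :=
    hasSum_ite_eq 0 _
  have h := hs.add h0
  rw [norm_sq_eq_tsum f]
  refine h.unique ?_
  convert (summable_norm_sq f).hasSum using 2 with β
  rw [← Finset.sum_mul, ← Finset.sum_div, ← Nat.cast_sum]
  by_cases hβ : β = 0
  · subst hβ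
    simp
  · have : ((∑ i, β i : ℕ) : ℝ) ≠ 0 := by
      rw [Nat.cast_ne_zero]
      intro h
      exact hβ (funext fun i => Finset.sum_eq_zero_iff.1 h i (Finset.mem_univ i))
    rw [div_self this, if_neg hβ, one_mul, add_zero]

/-- The eigenvalue equation expresses the coefficient at β + e_j through the one at β, so the
constant coefficient determines a joint eigenvector. -/
lemma eq_zero_of_adjoint_coordMul_eq_smul {d : ℕ} {μ : Fin d → ℂ} {f : DASpace d}
    (h : ∀ j, adjoint (coordMul j) f = μ j • f) (h0 : f 0 = 0) : f = 0 := by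
  have key : ∀ m : ℕ, ∀ α : Fin d → ℕ, ∑ i, α i = m → f α = 0 := by
    intro m
    induction m with
    | zero =>
      intro α hα
      have : α = 0 := funext fun i => Finset.sum_eq_zero_iff.1 hα i (Finset.mem_univ i)
      rw [this, h0]
    | succ m ih =>
      intro α hα
      obtain ⟨j, hj⟩ : ∃ j, α j ≠ 0 := by
        by_contra! hcon
        simp [hcon] at hα
      obtain ⟨β, rfl⟩ := mem_range_incr j hj
      have h2 : ∑ i, incr j β i = (∑ i, β i) + 1 := by simp [incr, Finset.sum_add_distrib]
      have h3 := adjoint_coordMul_apply j f β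
      have h4 : (μ j • f) β = μ j * f β := rfl
      rw [h j, h4, ih β (by omega), mul_zero] at h3
      have h5 : 0 < √(((β j : ℝ) + 1) / ((∑ i, β i : ℕ) + 1 : ℝ)) :=
        Real.sqrt_pos.2 (by positivity)
      exact (mul_eq_zero.1 h3.symm).resolve_left (Complex.ofReal_ne_zero.2 h5.ne')
  ext α
  exact key _ α rfl

/-- Common eigenvectors of compressions of the coordinate multiplications have eigenvalues in the
open ball. -/
lemma norm_lt_one_of_inner_coordMul {d : ℕ} {l : EuclideanSpace ℂ (Fin d)} {f : DASpace d}
    (hf : f ≠ 0) (h : ∀ j, inner ℂ f (coordMul j f) = l j * ((‖f‖ ^ 2 : ℝ) : ℂ)) : ‖l‖ < 1 := by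
  -- Summed over j, with the row identity, the right side is (1 - ‖l‖²)‖f‖² - |f_0|². If ‖l‖ ≥ 1,
  -- every term on the left vanishes and f_0 = 0.
  have key : ∀ j, ‖adjoint (coordMul j) f - (starRingEnd ℂ) (l j) • f‖ ^ 2 =
      ‖adjoint (coordMul j) f‖ ^ 2 - ‖l j‖ ^ 2 * ‖f‖ ^ 2 := by
    intro j
    rw [@norm_sub_sq ℂ, inner_smul_right, adjoint_inner_left, h j, ← mul_assoc,
      Complex.conj_mul', norm_smul, mul_pow]
    simp only [RCLike.norm_conj]
    rw [← Complex.ofReal_pow, ← Complex.ofReal_mul]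
    simp only [RCLike.re_to_complex, Complex.ofReal_re]
    ring
  have hsum := Finset.sum_congr (s₁ := Finset.univ) rfl fun j _ => key j
  rw [Finset.sum_sub_distrib, ← Finset.sum_mul, ← EuclideanSpace.norm_sq_eq] at hsum
  have hrow := sum_norm_sq_adjoint_coordMul f
  by_contra hl
  push Not at hl
  have hl2 : ‖f‖ ^ 2 ≤ ‖l‖ ^ 2 * ‖f‖ ^ 2 :=
    le_mul_of_one_le_left (by positivity) (one_le_pow₀ hl)
  have hnn : 0 ≤ ∑ j, ‖adjoint (coordMul j) f - (starRingEnd ℂ) (l j) • f‖ ^ 2 :=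
    Finset.sum_nonneg fun j _ => by positivity
  have hf0 : ‖f 0‖ ^ 2 = 0 := le_antisymm (by linarith) (by positivity)
  have hz : ∑ j, ‖adjoint (coordMul j) f - (starRingEnd ℂ) (l j) • f‖ ^ 2 = 0 :=
    le_antisymm (by linarith [sq_nonneg ‖f 0‖]) hnn
  rw [Finset.sum_eq_zero_iff_of_nonneg fun j _ => by positivity] at hz
  refine hf (eq_zero_of_adjoint_coordMul_eq_smul (μ := fun j => (starRingEnd ℂ) (l j))
    (fun j => ?_) (by simpa using hf0))
  have := hz j (Finset.mem_univ j)
  rwa [sq_eq_zero_iff, norm_eq_zero, sub_eq_zero] at this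

/-! ### Functions and multipliers -/

/-- On the complex line s ↦ s z the function is a power series in s that vanishes near 0; its
coefficients are the homogeneous parts at z. -/
lemma sum_coeff_eq_zero_of_evalAt_eq_zero {d : ℕ} {f : DASpace d}
    (hf : ∀ z : Ball d, evalAt f z = 0) (z : Fin d → ℂ) (m : ℕ) :
    ∑ α ∈ Finset.piAntidiag Finset.univ m, f α * (√(weight α) : ℂ) * ∏ j, z j ^ α j = 0 := by
  set a : ℕ → ℂ := fun m =>
    ∑ α ∈ Finset.piAntidiag Finset.univ m, f α * (√(weight α) : ℂ) * ∏ j, z j ^ α j with ha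
  let p : FormalMultilinearSeries ℂ ℂ ℂ := fun m => ContinuousMultilinearMap.mkPiRing ℂ (Fin m) (a m)
  have hp : ∀ m, p.coeff m = a m := fun m => by
    simp [p, FormalMultilinearSeries.coeff]
  have hser : HasFPowerSeriesAt (0 : ℂ → ℂ) p 0 := by
    rw [hasFPowerSeriesAt_iff]
    have hev : ∀ᶠ s : ℂ in nhds 0, ‖s • (WithLp.toLp 2 z : EuclideanSpace ℂ (Fin d))‖ < 1 := by
      refine ContinuousAt.eventually_lt (by fun_prop) (by fun_prop) ?_
      simp
    filter_upwards [hev] with s hs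
    let w : Ball d := ⟨s • (WithLp.toLp 2 z), mem_ball_zero_iff.2 hs⟩
    have h1 := (summable_evalAt f w).hasSum
    have h2 : ∑' α : Fin d → ℕ, f α * (√(weight α) : ℂ) *
        ∏ j, (w : EuclideanSpace ℂ (Fin d)) j ^ α j = 0 := hf w
    rw [h2] at h1
    have h3 := HasSum.tsum_fiberwise h1 (fun α : Fin d → ℕ => ∑ i, α i)
    simp only [Pi.zero_apply]
    convert h3 using 2 with m
    have hset : (fun α : Fin d → ℕ => ∑ i, α i) ⁻¹' {m} =
        ↑(Finset.piAntidiag (Finset.univ : Finset (Fin d)) m) := by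
      ext α
      simp
    rw [hset, Finset.tsum_subtype' (Finset.piAntidiag (Finset.univ : Finset (Fin d)) m)
      (fun α : Fin d → ℕ => f α * (√(weight α) : ℂ) *
        ∏ j, (w : EuclideanSpace ℂ (Fin d)) j ^ α j), hp, ha, Finset.smul_sum]
    refine Finset.sum_congr rfl fun α hα => ?_
    have hm : ∑ j, α j = m := (Finset.mem_piAntidiag.1 hα).1
    have : ∏ j, (w : EuclideanSpace ℂ (Fin d)) j ^ α j = s ^ m * ∏ j, z j ^ α j := by
      simp only [w, PiLp.smul_apply, smul_eq_mul, mul_pow, Finset.prod_mul_distrib]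
      rw [Finset.prod_pow_eq_pow_sum, hm]
    rw [this, smul_eq_mul]
    ring
  have h0 := hser.eq_zero
  have h1 := hp m
  rw [h0] at h1
  exact h1.symm.trans rfl

lemma eq_zero_of_evalAt_eq_zero {d : ℕ} {f : DASpace d} (hf : ∀ z : Ball d, evalAt f z = 0) :
    f = 0 := by
  classical
  ext α
  let q : MvPolynomial (Fin d) ℂ := ∑ β ∈ Finset.piAntidiag Finset.univ (∑ i, α i),
    MvPolynomial.monomial (Finsupp.equivFunOnFinite.symm β) (f β * (√(weight β) : ℂ))
  have hq : q = 0 := by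
    refine MvPolynomial.funext fun z => ?_
    rw [map_zero, ← sum_coeff_eq_zero_of_evalAt_eq_zero hf z (∑ i, α i), map_sum]
    refine Finset.sum_congr rfl fun β _ => ?_
    rw [MvPolynomial.eval_monomial, Finsupp.prod_fintype _ _ (fun i => pow_zero _)]
    simp
  have hc : q.coeff (Finsupp.equivFunOnFinite.symm α) = f α * (√(weight α) : ℂ) := by
    simp only [q, MvPolynomial.coeff_sum, MvPolynomial.coeff_monomial, EmbeddingLike.apply_eq_iff_eq]
    rw [Finset.sum_ite_eq', if_pos (by simp)]
  rw [hq, MvPolynomial.coeff_zero] at hc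
  have hw : (√(weight α) : ℂ) ≠ 0 :=
    Complex.ofReal_ne_zero.2 (Real.sqrt_pos.2 (weight_pos α)).ne'
  exact (mul_eq_zero.1 hc.symm).resolve_right hw

lemma evalAt_sub {d : ℕ} (f g : DASpace d) (z : Ball d) :
    evalAt (f - g) z = evalAt f z - evalAt g z := by
  unfold evalAt
  rw [← (summable_evalAt f z).tsum_sub (summable_evalAt g z)]
  refine tsum_congr fun α => ?_
  have : (f - g) α = f α - g α := rfl
  rw [this]
  ring

/-- A vector of the Drury–Arveson space is determined by its values. -/
lemma evalAt_injective {d : ℕ} {f g : DASpace d} (h : ∀ z, evalAt f z = evalAt g z) : f = g :=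
  sub_eq_zero.1 (eq_zero_of_evalAt_eq_zero fun z => by rw [evalAt_sub, h, sub_self])

lemma coordMul_mem_multiplierOperators {d : ℕ} (j : Fin d) :
    coordMul j ∈ multiplierOperators d :=
  ⟨fun z => (z : EuclideanSpace ℂ (Fin d)) j, fun g z => evalAt_coordMul j g z⟩

lemma comp_comm_of_mem_multiplierOperators {d : ℕ} {S T : DASpace d →L[ℂ] DASpace d}
    (hS : S ∈ multiplierOperators d) (hT : T ∈ multiplierOperators d) : S ∘L T = T ∘L S := by
  obtain ⟨φ, hφ⟩ := hS
  obtain ⟨ψ, hψ⟩ := hT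
  ext1 g
  refine evalAt_injective fun z => ?_
  simp only [comp_apply, hφ, hψ]
  ring

lemma adjoint_apply_comm {d : ℕ} {S T : DASpace d →L[ℂ] DASpace d}
    (hS : S ∈ multiplierOperators d) (hT : T ∈ multiplierOperators d) (g : DASpace d) :
    adjoint S (adjoint T g) = adjoint T (adjoint S g) := by
  have h := congrArg adjoint (comp_comm_of_mem_multiplierOperators hT hS)
  rw [adjoint_comp, adjoint_comp] at h
  exact DFunLike.congr_fun h g

/-! ### Derivatives of the reproducing kernels -/

/-- Grouping by total degree gives a geometric series, by the multinomial theorem. -/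
lemma summable_weight_mul_prod {d : ℕ} {t : Fin d → ℝ} (ht0 : ∀ j, 0 ≤ t j)
    (hT : ∑ j, t j < 1) : Summable fun α : Fin d → ℕ => weight α * ∏ j, t j ^ α j := by
  classical
  have hT0 : 0 ≤ ∑ j, t j := Finset.sum_nonneg fun j _ => ht0 j
  have hterm : ∀ α : Fin d → ℕ, 0 ≤ weight α * ∏ j, t j ^ α j := fun α =>
    mul_nonneg (weight_pos α).le (Finset.prod_nonneg fun j _ => pow_nonneg (ht0 j) _)
  refine summable_of_sum_le (c := ∑' m : ℕ, (∑ j, t j) ^ m) hterm fun s => ?_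
  set D : Finset ℕ := s.image fun α => ∑ j, α j
  calc ∑ α ∈ s, weight α * ∏ j, t j ^ α j
      ≤ ∑ α ∈ D.biUnion fun m => Finset.piAntidiag Finset.univ m, weight α * ∏ j, t j ^ α j := by
        refine Finset.sum_le_sum_of_subset_of_nonneg (fun α hα => ?_) fun α _ _ => hterm α
        simp only [Finset.mem_biUnion, Finset.mem_piAntidiag]
        exact ⟨∑ j, α j, Finset.mem_image_of_mem _ hα, rfl, fun _ _ => Finset.mem_univ _⟩
    _ = ∑ m ∈ D, (∑ j, t j) ^ m := by
        rw [Finset.sum_biUnion]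
        · exact Finset.sum_congr rfl fun m _ => sum_weight_degree t m
        · intro a _ b _ hab
          refine Finset.disjoint_left.2 fun α ha hb => hab ?_
          rw [← (Finset.mem_piAntidiag.1 ha).1, (Finset.mem_piAntidiag.1 hb).1]
    _ ≤ ∑' m : ℕ, (∑ j, t j) ^ m :=
        (summable_geometric_of_lt_one hT0 hT).sum_le_tsum _ fun m _ => pow_nonneg hT0 m

/-- One term of the binomial expansion of (r + ε)^a is at most the whole: differentiation costs only
a slightly larger radius. -/
lemma choose_mul_pow_le {r ε : ℝ} (hr : 0 ≤ r) (hε : 0 < ε) (a i : ℕ) :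
    (a.choose i : ℝ) * r ^ (a - i) ≤ (ε ^ i)⁻¹ * (r + ε) ^ a := by
  by_cases hi : i ≤ a
  · rw [inv_mul_eq_div, le_div_iff₀ (by positivity), add_comm r ε, add_pow]
    calc (a.choose i : ℝ) * r ^ (a - i) * ε ^ i = ε ^ i * r ^ (a - i) * (a.choose i : ℝ) := by ring
      _ ≤ _ := Finset.single_le_sum (f := fun m => ε ^ m * r ^ (a - m) * (a.choose m : ℝ))
          (fun m _ => by positivity) (Finset.mem_range.2 (by omega))
  · rw [Nat.choose_eq_zero_of_lt (by omega)]
    simp only [Nat.cast_zero, zero_mul]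
    positivity

/-- The factors of the coefficients of the `i`-th derivative of `∑ μ^α` in direction `j₀`. -/
def derivFactor {d : ℕ} (j₀ : Fin d) (μ : Fin d → ℂ) (i : ℕ) (j : Fin d) (a : ℕ) : ℂ :=
  if j = j₀ then (a.choose i : ℂ) * μ j ^ (a - i) else μ j ^ a

lemma memℓp_derivFactor {d : ℕ} (j₀ : Fin d) {μ : Fin d → ℂ} (hμ : ∑ j, ‖μ j‖ ^ 2 < 1) (i : ℕ) :
    Memℓp (fun α : Fin d → ℕ => (√(weight α) : ℂ) * ∏ j, derivFactor j₀ μ i j (α j)) 2 := by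
  let r : ℝ → Fin d → ℝ := fun ε j => if j = j₀ then ‖μ j‖ + ε else ‖μ j‖
  -- The ball is open, so the modulus of the `j₀` coordinate can be enlarged by some ε > 0.
  have hev : ∀ᶠ ε in nhdsWithin (0 : ℝ) (Set.Ioi 0), ∑ j, r ε j ^ 2 < 1 := by
    refine Filter.Eventually.filter_mono nhdsWithin_le_nhds ?_
    refine ContinuousAt.eventually_lt ?_ (by fun_prop) ?_
    · refine Continuous.continuousAt (continuous_finsetSum _ fun j _ => ?_)
      by_cases h : j = j₀
      · simp only [r, h, if_true]; fun_prop
      · simp only [r, h, if_false]; fun_prop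
    · simpa [r] using hμ
  obtain ⟨ε, hε1, hε⟩ := (hev.and self_mem_nhdsWithin).exists
  replace hε : 0 < ε := hε
  have hr : ∀ j, 0 ≤ r ε j := fun j => by
    by_cases h : j = j₀
    · simp only [r, h, if_true]; positivity
    · simp only [r, h, if_false]; positivity
  have hbound : ∀ α : Fin d → ℕ, ‖∏ j, derivFactor j₀ μ i j (α j)‖ ≤
      (ε ^ i)⁻¹ * ∏ j, r ε j ^ α j := by
    intro α
    rw [norm_prod, ← Finset.mul_prod_erase _ _ (Finset.mem_univ j₀),
      ← Finset.mul_prod_erase _ (fun j => r ε j ^ α j) (Finset.mem_univ j₀), ← mul_assoc]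
    refine mul_le_mul ?_ (le_of_eq ?_) (by positivity) ?_
    · simp only [derivFactor, if_true, norm_mul, norm_pow, r]
      rw [Complex.norm_natCast]
      exact choose_mul_pow_le (norm_nonneg _) hε _ _
    · refine Finset.prod_congr rfl fun j hj => ?_
      simp [derivFactor, r, Finset.ne_of_mem_erase hj]
    · have := hr j₀
      positivity
  have hsum := (summable_weight_mul_prod (t := fun j => r ε j ^ 2) (fun j => by positivity)
    hε1).mul_left (((ε ^ i)⁻¹) ^ 2)
  refine memℓp_gen (Summable.of_nonneg_of_le (fun _ => by positivity) (fun α => ?_) hsum)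
  have e1 : ∏ j, (r ε j ^ 2) ^ α j = (∏ j, r ε j ^ α j) ^ 2 := by
    rw [← Finset.prod_pow]
    exact Finset.prod_congr rfl fun j _ => by ring
  have e2 : ‖(√(weight α) : ℂ) * ∏ j, derivFactor j₀ μ i j (α j)‖ ^ 2 =
      weight α * ‖∏ j, derivFactor j₀ μ i j (α j)‖ ^ 2 := by
    rw [norm_mul, mul_pow, Complex.norm_real, Real.norm_of_nonneg (Real.sqrt_nonneg _),
      Real.sq_sqrt (weight_pos α).le]
  have e3 := pow_le_pow_left₀ (norm_nonneg _) (hbound α) 2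
  rw [e1]
  simp only [ENNReal.toReal_ofNat, Real.rpow_ofNat]
  rw [e2]
  calc weight α * ‖∏ j, derivFactor j₀ μ i j (α j)‖ ^ 2
      ≤ weight α * ((ε ^ i)⁻¹ * ∏ j, r ε j ^ α j) ^ 2 :=
        mul_le_mul_of_nonneg_left e3 (weight_pos α).le
    _ = _ := by ring

/-- The `i`-th derivative, divided by `i!`, of the reproducing kernel in direction `j₀` at the
point with coordinates `conj μ`. -/
def derivKernel {d : ℕ} (j₀ : Fin d) {μ : Fin d → ℂ} (hμ : ∑ j, ‖μ j‖ ^ 2 < 1) (i : ℕ) :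
    DASpace d :=
  ⟨fun α => (√(weight α) : ℂ) * ∏ j, derivFactor j₀ μ i j (α j), memℓp_derivFactor j₀ hμ i⟩

lemma derivKernel_apply {d : ℕ} (j₀ : Fin d) {μ : Fin d → ℂ} (hμ : ∑ j, ‖μ j‖ ^ 2 < 1) (i : ℕ)
    (α : Fin d → ℕ) :
    derivKernel j₀ hμ i α = (√(weight α) : ℂ) * ∏ j, derivFactor j₀ μ i j (α j) := rfl

lemma adjoint_coordMul_derivKernel_apply {d : ℕ} (j₀ : Fin d) {μ : Fin d → ℂ}
    (hμ : ∑ j, ‖μ j‖ ^ 2 < 1) (i : ℕ) (j : Fin d) (α : Fin d → ℕ) :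
    adjoint (coordMul j) (derivKernel j₀ hμ i) α = (√(weight α) : ℂ) *
      (derivFactor j₀ μ i j (α j + 1) *
        ∏ k ∈ Finset.univ.erase j, derivFactor j₀ μ i k (α k)) := by
  have h2 : √(((α j : ℝ) + 1) / ((∑ i, α i : ℕ) + 1 : ℝ)) * √(weight (incr j α))
      = √(weight α) := by
    rw [← Real.sqrt_mul (by positivity), weight_incr]
    congr 1
    field_simp
  rw [adjoint_coordMul_apply, derivKernel_apply, ← mul_assoc, ← Complex.ofReal_mul, h2,
    ← Finset.mul_prod_erase _ _ (Finset.mem_univ j)]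
  congr 2
  · simp [incr]
  · refine Finset.prod_congr rfl fun k hk => ?_
    simp [incr, Finset.ne_of_mem_erase hk]

lemma adjoint_coordMul_derivKernel_of_ne {d : ℕ} {j₀ : Fin d} {μ : Fin d → ℂ}
    (hμ : ∑ j, ‖μ j‖ ^ 2 < 1) (i : ℕ) {j : Fin d} (hj : j ≠ j₀) :
    adjoint (coordMul j) (derivKernel j₀ hμ i) = μ j • derivKernel j₀ hμ i := by
  ext α
  have h : (μ j • derivKernel j₀ hμ i) α = μ j * derivKernel j₀ hμ i α := rfl
  rw [adjoint_coordMul_derivKernel_apply, h, derivKernel_apply,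
    ← Finset.mul_prod_erase _ _ (Finset.mem_univ j)]
  simp only [derivFactor, hj, if_false, pow_succ]
  ring

lemma adjoint_coordMul_derivKernel_zero {d : ℕ} {j₀ : Fin d} {μ : Fin d → ℂ}
    (hμ : ∑ j, ‖μ j‖ ^ 2 < 1) :
    adjoint (coordMul j₀) (derivKernel j₀ hμ 0) = μ j₀ • derivKernel j₀ hμ 0 := by
  ext α
  have h : (μ j₀ • derivKernel j₀ hμ 0) α = μ j₀ * derivKernel j₀ hμ 0 α := rfl
  rw [adjoint_coordMul_derivKernel_apply, h, derivKernel_apply,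
    ← Finset.mul_prod_erase _ _ (Finset.mem_univ j₀)]
  simp only [derivFactor, if_true, Nat.choose_zero_right, Nat.sub_zero, pow_succ]
  ring

/-- By Pascal's rule, the derivatives of the kernel form a Jordan chain. -/
lemma adjoint_coordMul_derivKernel_succ {d : ℕ} {j₀ : Fin d} {μ : Fin d → ℂ}
    (hμ : ∑ j, ‖μ j‖ ^ 2 < 1) (i : ℕ) :
    adjoint (coordMul j₀) (derivKernel j₀ hμ (i + 1)) =
      μ j₀ • derivKernel j₀ hμ (i + 1) + derivKernel j₀ hμ i := by
  ext α
  have h : (μ j₀ • derivKernel j₀ hμ (i + 1) + derivKernel j₀ hμ i) α =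
    μ j₀ * derivKernel j₀ hμ (i + 1) α + derivKernel j₀ hμ i α := rfl
  have h1 : derivFactor j₀ μ (i + 1) j₀ (α j₀ + 1) =
      μ j₀ * derivFactor j₀ μ (i + 1) j₀ (α j₀) + derivFactor j₀ μ i j₀ (α j₀) := by
    simp only [derivFactor, if_true, Nat.choose_succ_succ, Nat.add_sub_add_right]
    by_cases hi : i + 1 ≤ α j₀
    · have : α j₀ - i = (α j₀ - (i + 1)) + 1 := by omega
      rw [this, pow_succ]
      push_cast
      ring
    -- The exponent is truncated here, but its binomial coefficient is 0.
    · rw [Nat.choose_eq_zero_of_lt (show α j₀ < i + 1 by omega)]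
      simp
  have h2 : ∀ i', ∏ k ∈ Finset.univ.erase j₀, derivFactor j₀ μ i' k (α k) =
      ∏ k ∈ Finset.univ.erase j₀, μ k ^ α k := fun i' =>
    Finset.prod_congr rfl fun k hk => by simp [derivFactor, Finset.ne_of_mem_erase hk]
  rw [adjoint_coordMul_derivKernel_apply, h, derivKernel_apply, derivKernel_apply,
    ← Finset.mul_prod_erase _ _ (Finset.mem_univ j₀),
    ← Finset.mul_prod_erase _ (fun j => derivFactor j₀ μ i j (α j)) (Finset.mem_univ j₀), h1, h2, h2]
  ring

lemma derivKernel_zero_apply_zero {d : ℕ} (j₀ : Fin d) {μ : Fin d → ℂ}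
    (hμ : ∑ j, ‖μ j‖ ^ 2 < 1) : derivKernel j₀ hμ 0 0 = 1 := by
  rw [derivKernel_apply]
  simp [derivFactor, weight]

/-! ### Local coinvariant subspaces -/

/-- The operator `M_{z_j}^* - s` as an endomorphism. -/
def shiftedAdjoint {d : ℕ} (j : Fin d) (s : ℂ) : Module.End ℂ (DASpace d) :=
  (adjoint (coordMul j) : DASpace d →ₗ[ℂ] DASpace d) - s • (1 : Module.End ℂ (DASpace d))

lemma shiftedAdjoint_apply {d : ℕ} (j : Fin d) (s : ℂ) (v : DASpace d) :
    shiftedAdjoint j s v = adjoint (coordMul j) v - s • v := rfl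

/-- The common kernel of `(M_{z_{j₀}}^* - μ_{j₀})^m` and `M_{z_j}^* - μ_j` for `j ≠ j₀`. -/
def localSpace {d : ℕ} (j₀ : Fin d) (μ : Fin d → ℂ) (m : ℕ) : Submodule ℂ (DASpace d) :=
  LinearMap.ker (shiftedAdjoint j₀ (μ j₀) ^ m) ⊓
    ⨅ j : {j // j ≠ j₀}, LinearMap.ker (shiftedAdjoint j.1 (μ j.1))

lemma mem_localSpace {d : ℕ} {j₀ : Fin d} {μ : Fin d → ℂ} {m : ℕ} {v : DASpace d} :
    v ∈ localSpace j₀ μ m ↔ (shiftedAdjoint j₀ (μ j₀) ^ m) v = 0 ∧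
      ∀ j, j ≠ j₀ → adjoint (coordMul j) v = μ j • v := by
  simp [localSpace, Submodule.mem_iInf, shiftedAdjoint_apply, sub_eq_zero]

/-- All adjoint multipliers commute with the M_{z_j}^*, so they preserve joint kernels of
polynomials in these. -/
lemma adjoint_mem_localSpace {d : ℕ} {j₀ : Fin d} {μ : Fin d → ℂ} {m : ℕ} {v : DASpace d}
    (hv : v ∈ localSpace j₀ μ m) {T : DASpace d →L[ℂ] DASpace d}
    (hT : T ∈ multiplierOperators d) : adjoint T v ∈ localSpace j₀ μ m := by
  rw [mem_localSpace] at hv ⊢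
  have hcomm : Commute (shiftedAdjoint j₀ (μ j₀)) (adjoint T : DASpace d →ₗ[ℂ] DASpace d) := by
    ext1 g
    have := adjoint_apply_comm (coordMul_mem_multiplierOperators j₀) hT g
    simp [shiftedAdjoint_apply, this]
  refine ⟨?_, fun j hj => ?_⟩
  · have := LinearMap.congr_fun (hcomm.pow_left m).eq v
    simp only [Module.End.mul_apply] at this
    rw [hv.1, map_zero] at this
    exact this
  · rw [adjoint_apply_comm (coordMul_mem_multiplierOperators j) hT, hv.2 j hj, map_smul]

lemma shiftedAdjoint_pow_derivKernel {d : ℕ} {j₀ : Fin d} {μ : Fin d → ℂ}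
    (hμ : ∑ j, ‖μ j‖ ^ 2 < 1) (m : ℕ) :
    (shiftedAdjoint j₀ (μ j₀) ^ m) (derivKernel j₀ hμ m) = derivKernel j₀ hμ 0 := by
  induction m with
  | zero => rfl
  | succ m ih =>
    rw [pow_succ, Module.End.mul_apply, shiftedAdjoint_apply, adjoint_coordMul_derivKernel_succ,
      add_sub_cancel_left, ih]

lemma localSpace_mono_succ {d : ℕ} (j₀ : Fin d) (μ : Fin d → ℂ) (m : ℕ) :
    localSpace j₀ μ m ≤ localSpace j₀ μ (m + 1) := by
  intro v hv
  rw [mem_localSpace] at hv ⊢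
  refine ⟨?_, hv.2⟩
  rw [pow_succ', Module.End.mul_apply, hv.1, map_zero]

lemma derivKernel_mem_localSpace {d : ℕ} (j₀ : Fin d) {μ : Fin d → ℂ}
    (hμ : ∑ j, ‖μ j‖ ^ 2 < 1) (m : ℕ) : derivKernel j₀ hμ m ∈ localSpace j₀ μ (m + 1) := by
  rw [mem_localSpace]
  refine ⟨?_, fun j hj => adjoint_coordMul_derivKernel_of_ne hμ m hj⟩
  rw [pow_succ', Module.End.mul_apply, shiftedAdjoint_pow_derivKernel, shiftedAdjoint_apply,
    adjoint_coordMul_derivKernel_zero, sub_self]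

lemma derivKernel_notMem_localSpace {d : ℕ} (j₀ : Fin d) {μ : Fin d → ℂ}
    (hμ : ∑ j, ‖μ j‖ ^ 2 < 1) (m : ℕ) : derivKernel j₀ hμ m ∉ localSpace j₀ μ m := by
  rw [mem_localSpace, shiftedAdjoint_pow_derivKernel]
  rintro ⟨h, -⟩
  have h1 := derivKernel_zero_apply_zero j₀ hμ
  rw [h] at h1
  exact zero_ne_one h1

/-- The m-th power of the shifted adjoint sends v to a joint eigenvector, hence to a multiple of the
kernel. Subtracting that multiple of the m-th derivative leaves a vector killed by the m-th power.
-/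
lemma localSpace_succ {d : ℕ} (j₀ : Fin d) {μ : Fin d → ℂ} (hμ : ∑ j, ‖μ j‖ ^ 2 < 1) (m : ℕ) :
    localSpace j₀ μ (m + 1) = localSpace j₀ μ m ⊔ Submodule.span ℂ {derivKernel j₀ hμ m} := by
  apply le_antisymm
  · intro v hv
    have hv' := mem_localSpace.1 hv
    set w := (shiftedAdjoint j₀ (μ j₀) ^ m) v with hw
    have hw1 : ∀ j, adjoint (coordMul j) w = μ j • w := by
      intro j
      by_cases hj : j = j₀
      · subst hj
        have := hv'.1
        rw [pow_succ', Module.End.mul_apply, ← hw, shiftedAdjoint_apply, sub_eq_zero] at this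
        exact this
      · have hcomm : Commute (shiftedAdjoint j₀ (μ j₀))
            (adjoint (coordMul j) : DASpace d →ₗ[ℂ] DASpace d) := by
          ext1 g
          have := adjoint_apply_comm (coordMul_mem_multiplierOperators j₀)
            (coordMul_mem_multiplierOperators j) g
          simp [shiftedAdjoint_apply, this]
        have := LinearMap.congr_fun (hcomm.pow_left m).eq v
        simp only [Module.End.mul_apply, coe_coe] at this
        rw [hw, ← this, hv'.2 j hj, map_smul]
    have hw2 : w - w 0 • derivKernel j₀ hμ 0 = 0 := by
      refine eq_zero_of_adjoint_coordMul_eq_smul (μ := μ) (fun j => ?_) ?_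
      · have hk : adjoint (coordMul j) (derivKernel j₀ hμ 0) = μ j • derivKernel j₀ hμ 0 := by
          by_cases hj : j = j₀
          · subst hj
            exact adjoint_coordMul_derivKernel_zero hμ
          · exact adjoint_coordMul_derivKernel_of_ne hμ 0 hj
        rw [map_sub, map_smul, hw1, hk, smul_sub, smul_comm]
      · have : (w - w 0 • derivKernel j₀ hμ 0) 0 = w 0 - w 0 * derivKernel j₀ hμ 0 0 := rfl
        rw [this, derivKernel_zero_apply_zero, mul_one, sub_self]
    have hmem : v - w 0 • derivKernel j₀ hμ m ∈ localSpace j₀ μ m := by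
      rw [mem_localSpace]
      refine ⟨?_, fun j hj => ?_⟩
      · rw [map_sub, map_smul, shiftedAdjoint_pow_derivKernel, ← hw, hw2]
      · rw [map_sub, map_smul, hv'.2 j hj, adjoint_coordMul_derivKernel_of_ne hμ m hj, smul_sub,
          smul_comm]
    rw [← sub_add_cancel v (w 0 • derivKernel j₀ hμ m)]
    exact Submodule.add_mem_sup hmem (Submodule.smul_mem _ _ (Submodule.mem_span_singleton_self _))
  · refine sup_le (localSpace_mono_succ j₀ μ m) ?_
    rw [Submodule.span_singleton_le_iff_mem]
    exact derivKernel_mem_localSpace j₀ hμ m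

lemma finrank_localSpace {d : ℕ} (j₀ : Fin d) {μ : Fin d → ℂ} (hμ : ∑ j, ‖μ j‖ ^ 2 < 1) (m : ℕ) :
    FiniteDimensional ℂ (localSpace j₀ μ m) ∧ Module.finrank ℂ (localSpace j₀ μ m) = m := by
  induction m with
  | zero =>
    have : localSpace j₀ μ 0 = ⊥ := by
      rw [eq_bot_iff]
      intro v hv
      simpa using (mem_localSpace.1 hv).1
    rw [this]
    exact ⟨inferInstance, finrank_bot ℂ _⟩
  | succ m ih =>
    obtain ⟨hfin, hrank⟩ := ih
    have hfin' : FiniteDimensional ℂ (localSpace j₀ μ (m + 1)) := by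
      rw [localSpace_succ j₀ hμ]
      infer_instance
    refine ⟨hfin', le_antisymm ?_ ?_⟩
    · rw [localSpace_succ j₀ hμ]
      refine (Submodule.finrank_add_le_finrank_add_finrank _ _).trans ?_
      rw [hrank]
      have := finrank_span_le_card (R := ℂ) {derivKernel j₀ hμ m}
      simp only [Set.toFinset_singleton, Finset.card_singleton] at this
      omega
    · have hlt : localSpace j₀ μ m < localSpace j₀ μ (m + 1) := by
        refine lt_of_le_of_ne (localSpace_mono_succ j₀ μ m) fun h => ?_
        refine derivKernel_notMem_localSpace j₀ hμ m ?_
        rw [h]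
        exact derivKernel_mem_localSpace j₀ hμ m
      have := Submodule.finrank_lt_finrank_of_lt hlt
      omega

/-! ### The compressed shift and its adjoint -/

lemma det_adjoint {E : Type*} [NormedAddCommGroup E] [InnerProductSpace ℂ E]
    [FiniteDimensional ℂ E] (B : Module.End ℂ E) :
    LinearMap.det (LinearMap.adjoint B) = (starRingEnd ℂ) (LinearMap.det B) := by
  let b := stdOrthonormalBasis ℂ E
  rw [← LinearMap.det_toMatrix b.toBasis, ← LinearMap.det_toMatrix b.toBasis,
    LinearMap.toMatrix_adjoint, Matrix.det_conjTranspose]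
  rfl

section Compression

variable {d n : ℕ} {P : DASpace d →L[ℂ] DASpace d}

lemma apply_eq_self_of_mem_range (hP : P ∈ coinvariantProjections d n) {v : DASpace d}
    (hv : v ∈ LinearMap.range (P : DASpace d →ₗ[ℂ] DASpace d)) : P v = v := by
  obtain ⟨u, rfl⟩ := hv
  exact DFunLike.congr_fun hP.1 u

lemma inner_apply_left (hP : P ∈ coinvariantProjections d n) (u v : DASpace d) :
    inner ℂ (P u) v = inner ℂ u (P v) := by
  rw [← adjoint_inner_left, hP.2.1]

lemma adjoint_mem_range (hP : P ∈ coinvariantProjections d n) {T : DASpace d →L[ℂ] DASpace d}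
    (hT : T ∈ multiplierOperators d) (v : DASpace d)
    (hv : v ∈ LinearMap.range (P : DASpace d →ₗ[ℂ] DASpace d)) :
    adjoint T v ∈ LinearMap.range (P : DASpace d →ₗ[ℂ] DASpace d) := by
  have h := DFunLike.congr_fun (hP.2.2.1 T hT) v
  simp only [comp_apply, apply_eq_self_of_mem_range hP hv] at h
  exact ⟨_, h⟩

/-- The restriction of `M_{z_j}^*` to a coinvariant subspace. -/
def adjointShift (hP : P ∈ coinvariantProjections d n) (j : Fin d) :
    Module.End ℂ (LinearMap.range (P : DASpace d →ₗ[ℂ] DASpace d)) :=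
  (adjoint (coordMul j) : DASpace d →ₗ[ℂ] DASpace d).restrict
    (adjoint_mem_range hP (coordMul_mem_multiplierOperators j))

lemma coe_adjointShift (hP : P ∈ coinvariantProjections d n) (j : Fin d)
    (v : LinearMap.range (P : DASpace d →ₗ[ℂ] DASpace d)) :
    (adjointShift hP j v : DASpace d) = adjoint (coordMul j) (v : DASpace d) := rfl

lemma coe_compressedShift (j : Fin d) (v : LinearMap.range (P : DASpace d →ₗ[ℂ] DASpace d)) :
    (compressedShift P j v : DASpace d) = P (coordMul j (v : DASpace d)) := rfl

lemma commute_adjointShift (hP : P ∈ coinvariantProjections d n) (i j : Fin d) :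
    Commute (adjointShift hP i) (adjointShift hP j) := by
  refine LinearMap.ext fun v => Subtype.ext ?_
  exact adjoint_apply_comm (coordMul_mem_multiplierOperators i)
    (coordMul_mem_multiplierOperators j) v

lemma compressedShift_eq_adjoint (hP : P ∈ coinvariantProjections d n)
    [FiniteDimensional ℂ (LinearMap.range (P : DASpace d →ₗ[ℂ] DASpace d))] (j : Fin d) :
    compressedShift P j = LinearMap.adjoint (adjointShift hP j) := by
  rw [LinearMap.eq_adjoint_iff]
  intro u v
  rw [Submodule.coe_inner, Submodule.coe_inner, coe_compressedShift, coe_adjointShift,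
    inner_apply_left hP, apply_eq_self_of_mem_range hP v.2, adjoint_inner_right]

lemma commute_compressedShift (hP : P ∈ coinvariantProjections d n) (i j : Fin d) :
    Commute (compressedShift P i) (compressedShift P j) := by
  have := hP.2.2.2.1
  rw [compressedShift_eq_adjoint hP, compressedShift_eq_adjoint hP, Commute, SemiconjBy,
    Module.End.mul_eq_comp, Module.End.mul_eq_comp, ← LinearMap.adjoint_comp,
    ← LinearMap.adjoint_comp, ← Module.End.mul_eq_comp, ← Module.End.mul_eq_comp,
    (commute_adjointShift hP i j).eq]

/-- The compressed shift is the adjoint of the restricted M_z^*, so the two spectra are complex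
conjugate. -/
lemma det_compressedShift (hP : P ∈ coinvariantProjections d n) (c : Fin d → ℂ) (t : ℂ) :
    LinearMap.det (t • (1 : Module.End ℂ (LinearMap.range (P : DASpace d →ₗ[ℂ] DASpace d))) -
      ∑ j, c j • compressedShift P j) =
    (starRingEnd ℂ) (LinearMap.det ((starRingEnd ℂ) t • (1 : Module.End ℂ
      (LinearMap.range (P : DASpace d →ₗ[ℂ] DASpace d))) -
        ∑ j, (starRingEnd ℂ) (c j) • adjointShift hP j)) := by
  have := hP.2.2.2.1
  rw [← det_adjoint]
  congr 1
  rw [map_sub, map_sum, map_smulₛₗ, Complex.conj_conj]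
  have h1 : LinearMap.adjoint (1 : Module.End ℂ
      (LinearMap.range (P : DASpace d →ₗ[ℂ] DASpace d))) = 1 := by
    symm
    rw [LinearMap.eq_adjoint_iff]
    exact fun _ _ => rfl
  rw [h1]
  congr 1
  refine Finset.sum_congr rfl fun j _ => ?_
  rw [map_smulₛₗ, Complex.conj_conj, compressedShift_eq_adjoint hP]

lemma norm_lt_one_of_mem_jointSpectrum (hP : P ∈ coinvariantProjections d n)
    {l : EuclideanSpace ℂ (Fin d)} (hl : l ∈ jointSpectrum (compressedShift P)) : ‖l‖ < 1 := by
  obtain ⟨v, hv0, hv⟩ := mem_jointSpectrum_iff_exists.1 hl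
  refine norm_lt_one_of_inner_coordMul (f := (v : DASpace d)) (by simpa using hv0) fun j => ?_
  have h := congrArg Subtype.val (hv j)
  rw [coe_compressedShift, Submodule.coe_smul] at h
  nth_rewrite 1 [← apply_eq_self_of_mem_range hP v.2]
  rw [inner_apply_left hP, h, inner_smul_right, inner_self_eq_norm_sq_to_K]
  push_cast
  rfl

/-- The joint spectrum with multiplicities of the compressed shift consists of `n` points of the
ball. -/
lemma exists_ball_spectral_tuple (hP : P ∈ coinvariantProjections d n) :
    ∃ x : Fin n → Ball d,
      (∀ l, Nat.card {i // (x i : EuclideanSpace ℂ (Fin d)) = l} =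
        jointSpectrumMult (compressedShift P) l) ∧
      ∀ (c : Fin d → ℂ) (t : ℂ),
        LinearMap.det (t • (1 : Module.End ℂ (LinearMap.range (P : DASpace d →ₗ[ℂ] DASpace d))) -
          ∑ j, c j • compressedShift P j) =
        ∏ i, (t - ∑ j, c j * (x i : EuclideanSpace ℂ (Fin d)) j) := by
  have := hP.2.2.2.1
  obtain ⟨x, hx, hdet⟩ := exists_spectral_tuple (commute_compressedShift hP) hP.2.2.2.2
  have hball : ∀ i, x i ∈ Metric.ball (0 : EuclideanSpace ℂ (Fin d)) 1 := by
    intro i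
    rw [mem_ball_zero_iff]
    refine norm_lt_one_of_mem_jointSpectrum hP ?_
    by_contra h
    have h1 := hx (x i)
    rw [jointSpectrumMult, if_neg h, Nat.card_eq_zero] at h1
    rcases h1 with h1 | h1
    · exact h1.elim ⟨i, rfl⟩
    · exact h1.not_finite inferInstance
  exact ⟨fun i => ⟨x i, hball i⟩, hx, hdet⟩

end Compression

/-! ### Existence of coinvariant subspaces with prescribed spectrum -/

lemma finrank_finset_sup_le {ι V : Type*} [AddCommGroup V] [Module ℂ V] (s : Finset ι)
    (U : ι → Submodule ℂ V) [∀ i, FiniteDimensional ℂ (U i)] :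
    Module.finrank ℂ (s.sup U : Submodule ℂ V) ≤ ∑ i ∈ s, Module.finrank ℂ (U i) := by
  classical
  induction s using Finset.induction_on with
  | empty => simp
  | insert a s ha ih =>
    rw [Finset.sup_insert, Finset.sum_insert ha]
    exact (Submodule.finrank_add_le_finrank_add_finrank _ _).trans (by omega)

/-- A tuple whose multiplicities are dominated by those of a tuple that is not longer is a
reordering of it. -/
lemma exists_equiv_of_card_fiber_le {n m : ℕ} {β : Type*} (x : Fin n → β) (y : Fin m → β)
    (hmn : m ≤ n) (h : ∀ b, Nat.card {i // x i = b} ≤ Nat.card {i // y i = b}) :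
    ∃ e : Fin n ≃ Fin m, ∀ i, y (e i) = x i := by
  classical
  have emb : ∀ b, {i // x i = b} ↪ {i // y i = b} := fun b => by
    refine (Function.Embedding.nonempty_of_card_le ?_).some
    rw [← Nat.card_eq_fintype_card, ← Nat.card_eq_fintype_card]
    exact h b
  let F : Fin n ↪ Fin m := ((Equiv.sigmaFiberEquiv x).symm.toEmbedding.trans
    (Function.Embedding.sigmaMap (Function.Embedding.refl β) emb)).trans
      (Equiv.sigmaFiberEquiv y).toEmbedding
  have hF : ∀ i, y (F i) = x i := fun i => (emb (x i) ⟨i, rfl⟩).2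
  have hnm : n = m := le_antisymm (by simpa using Fintype.card_le_of_embedding F) hmn
  subst hnm
  exact ⟨Equiv.ofBijective F (Finite.injective_iff_bijective.1 F.injective), hF⟩

lemma ball_sum_norm_sq_lt {d : ℕ} (z : Ball d) :
    ∑ j, ‖(starRingEnd ℂ) ((z : EuclideanSpace ℂ (Fin d)) j)‖ ^ 2 < 1 := by
  simp only [RCLike.norm_conj]
  rw [← EuclideanSpace.norm_sq_eq]
  exact pow_lt_one₀ (norm_nonneg _) (mem_ball_zero_iff.1 z.2) two_ne_zero

theorem exists_projection_of_tuple {d n : ℕ} (hd : 1 ≤ d) (x : Fin n → Ball d) :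
    ∃ P ∈ coinvariantProjections d n, ∀ l, jointSpectrumMult (compressedShift P) l =
      Nat.card {i // (x i : EuclideanSpace ℂ (Fin d)) = l} := by
  classical
  -- Any coordinate direction would do for the Jordan chains; one exists because d ≥ 1.
  let j₀ : Fin d := ⟨0, hd⟩
  let mult : Ball d → ℕ := fun z => Nat.card {i // x i = z}
  let conjVec : Ball d → Fin d → ℂ := fun z j => (starRingEnd ℂ) ((z : EuclideanSpace ℂ (Fin d)) j)
  let U : Ball d → Submodule ℂ (DASpace d) := fun z => localSpace j₀ (conjVec z) (mult z)
  have hUfin : ∀ z, FiniteDimensional ℂ (U z) := fun z =>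
    (finrank_localSpace j₀ (ball_sum_norm_sq_lt z) _).1
  have hUrank : ∀ z, Module.finrank ℂ (U z) = mult z := fun z =>
    (finrank_localSpace j₀ (ball_sum_norm_sq_lt z) _).2
  let V : Submodule ℂ (DASpace d) := (Finset.univ.image x).sup U
  have hVfin : FiniteDimensional ℂ V := Submodule.finiteDimensional_finset_sup _ _
  -- The upper bound is enough: independence of the local spaces follows from the multiplicity count
  -- below.
  have hVrank : Module.finrank ℂ V ≤ n := by
    refine (finrank_finset_sup_le _ U).trans (le_of_eq ?_)
    simp only [hUrank, mult, Nat.card_eq_fintype_card, Fintype.card_subtype]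
    rw [← Finset.card_eq_sum_card_image, Finset.card_univ, Fintype.card_fin]
  have hVinv : ∀ T ∈ multiplierOperators d, ∀ v ∈ V, adjoint T v ∈ V := by
    intro T hT v hv
    have : V ≤ V.comap (adjoint T : DASpace d →ₗ[ℂ] DASpace d) := by
      refine Finset.sup_le fun z hz v hv => ?_
      exact Finset.le_sup (f := U) hz (adjoint_mem_localSpace hv hT)
    exact this hv
  let P := V.starProjection
  have hrange : LinearMap.range (P : DASpace d →ₗ[ℂ] DASpace d) = V := V.range_starProjection
  obtain ⟨m, hm⟩ : ∃ m, Module.finrank ℂ V = m := ⟨_, rfl⟩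
  have hP : P ∈ coinvariantProjections d m := by
    refine ⟨V.isIdempotentElem_starProjection, ?_, fun T hT => ?_, ?_, ?_⟩
    · exact (ContinuousLinearMap.isSelfAdjoint_iff'.1 (isSelfAdjoint_starProjection V))
    · ext1 g
      simp only [comp_apply]
      exact Submodule.starProjection_eq_self_iff.2 (hVinv T hT _ (V.starProjection_apply_mem g))
    · rw [hrange]; exact hVfin
    · rw [hrange]; exact hm
  have hRfin := hP.2.2.2.1
  obtain ⟨y, hy, hydet⟩ := exists_spectral_tuple (commute_adjointShift hP) hP.2.2.2.2
  let x' : Fin n → EuclideanSpace ℂ (Fin d) := fun i => WithLp.toLp 2 (conjVec (x i))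
  have hle : ∀ l, Nat.card {i // x' i = l} ≤ Nat.card {i // y i = l} := by
    intro l
    by_cases hl : ∃ i, x' i = l
    · obtain ⟨i₀, rfl⟩ := hl
      have hx' : ∀ i, x' i = x' i₀ ↔ x i = x i₀ := by
        intro i
        refine ⟨fun h => ?_, fun h => by simp only [x', h]⟩
        ext j
        have := congrArg (fun v : EuclideanSpace ℂ (Fin d) => v j) h
        exact (starRingEnd ℂ).injective this
      rw [hy, jointSpectrumMult_eq_finrank (commute_adjointShift hP),
        Nat.card_congr (Equiv.subtypeEquivRight hx')]
      change mult (x i₀) ≤ _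
      rw [← hUrank]
      have hUV : U (x i₀) ≤ LinearMap.range (P : DASpace d →ₗ[ℂ] DASpace d) := by
        rw [hrange]
        exact Finset.le_sup (f := U) (Finset.mem_image_of_mem x (Finset.mem_univ i₀))
      have hpow : ∀ (j : Fin d) (k : ℕ) (s : ℂ)
          (v : LinearMap.range (P : DASpace d →ₗ[ℂ] DASpace d)),
          ((((adjointShift hP j - s • 1 : Module.End ℂ _) ^ k) v :
            LinearMap.range (P : DASpace d →ₗ[ℂ] DASpace d)) : DASpace d) =
            (shiftedAdjoint j s ^ k) (v : DASpace d) := by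
        intro j k s v
        induction k with
        | zero => rfl
        | succ k ih =>
          rw [pow_succ', pow_succ', Module.End.mul_apply, Module.End.mul_apply, ← ih]
          rfl
      have hmem : ∀ v : U (x i₀), Submodule.inclusion hUV v ∈
          jointGenEigenspace (adjointShift hP) (x' i₀) := by
        intro v
        have hv := mem_localSpace.1 v.2
        rw [mem_jointGenEigenspace]
        intro j
        by_cases hj : j = j₀
        · subst hj
          refine ⟨mult (x i₀), Subtype.ext ?_⟩
          rw [hpow]
          exact hv.1
        · refine ⟨1, Subtype.ext ?_⟩
          rw [hpow, pow_one, shiftedAdjoint_apply]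
          exact sub_eq_zero.2 (hv.2 j hj)
      refine LinearMap.finrank_le_finrank_of_injective
        (f := (Submodule.inclusion hUV).codRestrict _ hmem) ?_
      intro u v huv
      exact Submodule.inclusion_injective hUV (congrArg Subtype.val huv)
    · have : IsEmpty {i // x' i = l} := ⟨fun i => hl ⟨i.1, i.2⟩⟩
      simp
  -- The `m` eigenvalues contain the `n` conjugate points with multiplicity and m ≤ n, so the lists
  -- agree and n = m.
  obtain ⟨e, he⟩ := exists_equiv_of_card_fiber_le x' y (hm ▸ hVrank) hle
  have hnm : n = m := by simpa using Fintype.card_congr e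
  subst hnm
  refine ⟨P, hP, fun l => ?_⟩
  obtain ⟨w, hw, hwdet⟩ := exists_ball_spectral_tuple hP
  rw [← hw l]
  refine card_fiber_eq_of_forall_prod_eq (fun i => (w i : EuclideanSpace ℂ (Fin d)))
    (fun i => (x i : EuclideanSpace ℂ (Fin d))) (fun c t => ?_) l
  rw [← hwdet, det_compressedShift hP, hydet, ← e.prod_comp, map_prod]
  refine Finset.prod_congr rfl fun i _ => ?_
  rw [he]
  simp [x', conjVec]

/-! ### Continuity -/

/-- In a basis the matrices factor as Φ B W and Φ W. This allows determinants on different subspaces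
to be compared by pairing with fixed vectors. -/
lemma det_dual_apply_apply {n : ℕ} {V : Type*} [AddCommGroup V] [Module ℂ V]
    [FiniteDimensional ℂ V] (hn : Module.finrank ℂ V = n) (B : Module.End ℂ V)
    (φ : Fin n → Module.Dual ℂ V) (w : Fin n → V) :
    Matrix.det (Matrix.of fun k i => φ k (B (w i))) =
      LinearMap.det B * Matrix.det (Matrix.of fun k i => φ k (w i)) := by
  let b := Module.finBasisOfFinrankEq ℂ V hn
  have hφ : ∀ k v, φ k v = ∑ p, φ k (b p) * b.repr v p := by
    intro k v
    conv_lhs => rw [← b.sum_repr v]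
    rw [map_sum]
    simp only [map_smul, smul_eq_mul, mul_comm]
  have h1 : (Matrix.of fun k i => φ k (w i)) =
      (Matrix.of fun k p => φ k (b p)) * (Matrix.of fun p i => b.repr (w i) p) := by
    ext k i
    simp only [Matrix.mul_apply, Matrix.of_apply]
    exact hφ k (w i)
  have h2 : (Matrix.of fun k i => φ k (B (w i))) =
      (Matrix.of fun k p => φ k (b p)) *
        (LinearMap.toMatrix b b B * (Matrix.of fun p i => b.repr (w i) p)) := by
    ext k i
    simp only [Matrix.mul_apply, Matrix.of_apply]
    rw [hφ k (B (w i))]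
    refine Finset.sum_congr rfl fun p _ => ?_
    congr 1
    exact (congrFun (LinearMap.toMatrix_mulVec_repr b b B (w i)) p).symm
  rw [h1, h2, Matrix.det_mul, Matrix.det_mul, Matrix.det_mul, LinearMap.det_toMatrix]
  ring

/-- The Gram type determinant of `(t - ∑ c_j Q M_{z_j}) Q` along a tuple `e`. -/
def compressionDet {d n : ℕ} (e : Fin n → DASpace d) (c : Fin d → ℂ) (t : ℂ)
    (Q : DASpace d →L[ℂ] DASpace d) : ℂ :=
  Matrix.det (Matrix.of fun k i : Fin n =>
    inner ℂ (e k) (t • Q (e i) - ∑ j, c j • Q (coordMul j (Q (e i)))))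

/-- The Gram type determinant of `Q` along a tuple `e`. -/
def gramDet {d n : ℕ} (e : Fin n → DASpace d) (Q : DASpace d →L[ℂ] DASpace d) : ℂ :=
  Matrix.det (Matrix.of fun k i : Fin n => inner ℂ (e k) (Q (e i)))

lemma continuous_compressionDet {d n : ℕ} (e : Fin n → DASpace d) (c : Fin d → ℂ) (t : ℂ) :
    Continuous (compressionDet e c t) := by
  unfold compressionDet
  refine Continuous.matrix_det (continuous_matrix fun k i => ?_)
  simp only [Matrix.of_apply]
  fun_prop

lemma continuous_gramDet {d n : ℕ} (e : Fin n → DASpace d) :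
    Continuous (gramDet (d := d) e) := by
  unfold gramDet
  refine Continuous.matrix_det (continuous_matrix fun k i => ?_)
  simp only [Matrix.of_apply]
  fun_prop

lemma compressionDet_eq {d n : ℕ} {P : DASpace d →L[ℂ] DASpace d}
    (hP : P ∈ coinvariantProjections d n) (e : Fin n → DASpace d) (c : Fin d → ℂ) (t : ℂ) :
    compressionDet e c t P =
      LinearMap.det (t • (1 : Module.End ℂ (LinearMap.range (P : DASpace d →ₗ[ℂ] DASpace d))) -
        ∑ j, c j • compressedShift P j) * gramDet e P := by
  have := hP.2.2.2.1
  have h := det_dual_apply_apply hP.2.2.2.2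
    (t • (1 : Module.End ℂ (LinearMap.range (P : DASpace d →ₗ[ℂ] DASpace d))) -
        ∑ j, c j • compressedShift P j)
    (fun k => (innerSL ℂ (e k) : DASpace d →ₗ[ℂ] ℂ) ∘ₗ
      (LinearMap.range (P : DASpace d →ₗ[ℂ] DASpace d)).subtype)
    (fun i => (P : DASpace d →ₗ[ℂ] DASpace d).rangeRestrict (e i))
  refine Eq.trans ?_ h
  unfold compressionDet
  congr 1
  ext k i
  simp [coe_compressedShift, inner_sub_right, inner_sum, inner_smul_right]

lemma exists_gramDet_eq_one {d n : ℕ} {P : DASpace d →L[ℂ] DASpace d}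
    (hP : P ∈ coinvariantProjections d n) : ∃ e : Fin n → DASpace d, gramDet e P = 1 := by
  have := hP.2.2.2.1
  let b := (stdOrthonormalBasis ℂ (LinearMap.range (P : DASpace d →ₗ[ℂ] DASpace d))).reindex
    (finCongr hP.2.2.2.2)
  refine ⟨fun i => (b i : DASpace d), ?_⟩
  have h : (Matrix.of fun k i : Fin n => inner ℂ (b k : DASpace d) (P (b i : DASpace d))) = 1 := by
    ext k i
    rw [Matrix.of_apply, apply_eq_self_of_mem_range hP (b i).2, ← Submodule.coe_inner,
      orthonormal_iff_ite.1 b.orthonormal, Matrix.one_apply]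
  rw [gramDet, h, Matrix.det_one]

/-! ### The pseudohyperbolic distance near the diagonal -/

lemma ballInvolution_self {d : ℕ} (x : EuclideanSpace ℂ (Fin d)) : ballInvolution x x = 0 := by
  by_cases hx : x = 0
  · subst hx
    simp [ballInvolution]
  · have h : inner ℂ x x / ((‖x‖ ^ 2 : ℝ) : ℂ) = 1 := by
      rw [inner_self_eq_norm_sq_to_K, Complex.ofReal_pow]
      exact div_self (pow_ne_zero 2 (by simpa using hx))
    simp only [ballInvolution, h, one_smul, sub_self, smul_zero]

/-- The projection onto the line of l has no limit as l → 0, so x = 0 is treated apart; there the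
map is the identity. -/
lemma continuousAt_ballInvolution {d : ℕ} {x : EuclideanSpace ℂ (Fin d)} (hx : ‖x‖ < 1) :
    ContinuousAt (fun l => ballInvolution l x) x := by
  by_cases h0 : x = 0
  · subst h0
    simp only [ballInvolution, inner_zero_right, zero_div, zero_smul, sub_zero, smul_zero, inv_one,
      one_smul]
    exact continuousAt_id
  · have h1 : (1 : ℂ) - inner ℂ x x ≠ 0 := by
      rw [inner_self_eq_norm_sq_to_K, sub_ne_zero]
      intro h
      have h2 : (1 : ℝ) = ‖x‖ ^ 2 := Complex.ofReal_injective (by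
        rw [Complex.ofReal_pow, Complex.ofReal_one]
        exact h)
      have h3 : ‖x‖ ^ 2 < 1 := pow_lt_one₀ (norm_nonneg _) hx two_ne_zero
      linarith
    have h2 : ((‖x‖ ^ 2 : ℝ) : ℂ) ≠ 0 := by
      rw [Complex.ofReal_ne_zero]
      exact pow_ne_zero 2 (norm_ne_zero_iff.2 h0)
    have hnum : ContinuousAt (fun l : EuclideanSpace ℂ (Fin d) => inner ℂ l x) x := by fun_prop
    have hden : ContinuousAt (fun l : EuclideanSpace ℂ (Fin d) => ((‖l‖ ^ 2 : ℝ) : ℂ)) x := by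
      fun_prop
    unfold ballInvolution
    have hq : ContinuousAt (fun l : EuclideanSpace ℂ (Fin d) =>
        (inner ℂ l x / ((‖l‖ ^ 2 : ℝ) : ℂ)) • l) x :=
      (ContinuousAt.div hnum hden h2).smul continuousAt_id
    refine ContinuousAt.smul (ContinuousAt.inv₀ (continuousAt_const.sub hnum) h1) ?_
    have hroot : ContinuousAt (fun l : EuclideanSpace ℂ (Fin d) =>
        ((√(1 - ‖l‖ ^ 2) : ℝ) : ℂ)) x := by fun_prop
    have hperp : ContinuousAt (fun l : EuclideanSpace ℂ (Fin d) =>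
        x - (inner ℂ l x / ((‖l‖ ^ 2 : ℝ) : ℂ)) • l) x := continuousAt_const.sub hq
    exact (continuousAt_id.sub hq).sub (hroot.smul hperp)

lemma symDist_mk_lt {d n : ℕ} {x y : Fin n → Ball d} {ε : ℝ} (hε : 0 < ε)
    (s : Equiv.Perm (Fin n)) (h : ∀ i, phDist (x i) (y (s i)) < ε) :
    symDist (Quotient.mk (permSetoid d n) x) (Quotient.mk (permSetoid d n) y) < ε := by
  refine lt_of_le_of_lt (ciInf_le (f := fun s : Equiv.Perm (Fin n) => polyDist x (y ∘ s))
    (Set.finite_range _).bddBelow s) ?_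
  unfold polyDist
  -- For n = 0 the supremum over the empty family is 0.
  rcases isEmpty_or_nonempty (Fin n) with hn | hn
  · rw [Real.iSup_of_isEmpty]
    exact hε
  · obtain ⟨i, hi⟩ := exists_eq_ciSup_of_finite (f := fun j => phDist (x j) ((y ∘ s) j))
    rw [← hi]
    exact h i

lemma exists_subseq_phDist_lt {d n : ℕ} {P : DASpace d →L[ℂ] DASpace d}
    (hP : P ∈ coinvariantProjections d n) {Q : ℕ → DASpace d →L[ℂ] DASpace d}
    (hQ : ∀ k, Q k ∈ coinvariantProjections d n)
    (hlim : Filter.Tendsto Q Filter.atTop (nhds P)) {y : Fin n → Ball d} {x : ℕ → Fin n → Ball d}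
    (hy : ∀ (c : Fin d → ℂ) (t : ℂ),
      LinearMap.det (t • (1 : Module.End ℂ (LinearMap.range (P : DASpace d →ₗ[ℂ] DASpace d))) -
        ∑ j, c j • compressedShift P j) =
      ∏ i, (t - ∑ j, c j * (y i : EuclideanSpace ℂ (Fin d)) j))
    (hx : ∀ (k : ℕ) (c : Fin d → ℂ) (t : ℂ),
      LinearMap.det (t • (1 : Module.End ℂ
          (LinearMap.range (Q k : DASpace d →ₗ[ℂ] DASpace d))) -
        ∑ j, c j • compressedShift (Q k) j) =
      ∏ i, (t - ∑ j, c j * (x k i : EuclideanSpace ℂ (Fin d)) j))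
    {ε : ℝ} (hε : 0 < ε) :
    ∃ (k : ℕ) (s : Equiv.Perm (Fin n)), ∀ i, phDist (x k i) (y (s i)) < ε := by
  let K : Set (Fin n → EuclideanSpace ℂ (Fin d)) :=
    Set.pi Set.univ fun _ => Metric.closedBall 0 1
  have hK : IsCompact K := isCompact_univ_pi fun _ => isCompact_closedBall _ _
  obtain ⟨a, -, σ, hσ, ha⟩ := hK.tendsto_subseq
    (x := fun k i => (x k i : EuclideanSpace ℂ (Fin d)))
    (fun k i _ => Metric.ball_subset_closedBall (x k i).2)
  obtain ⟨e, he⟩ := exists_gramDet_eq_one hP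
  have hlim' := hlim.comp hσ.tendsto_atTop
  have hprod : ∀ (c : Fin d → ℂ) (t : ℂ), ∏ i, (t - ∑ j, c j * a i j) =
      ∏ i, (t - ∑ j, c j * (y i : EuclideanSpace ℂ (Fin d)) j) := by
    intro c t
    have h1 : Filter.Tendsto (fun k => compressionDet e c t (Q (σ k))) Filter.atTop
        (nhds (compressionDet e c t P)) :=
      ((continuous_compressionDet e c t).tendsto P).comp hlim'
    have h2 : Filter.Tendsto (fun k => gramDet e (Q (σ k))) Filter.atTop (nhds (gramDet e P)) :=
      ((continuous_gramDet e).tendsto P).comp hlim'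
    have hcont : Continuous fun b : Fin n → EuclideanSpace ℂ (Fin d) =>
        ∏ i, (t - ∑ j, c j * b i j) := by fun_prop
    -- Passing to the limit in the product identity needs no division; only the limiting Gram
    -- determinant must be nonzero, and `e` makes it 1.
    have h3 := ((hcont.tendsto a).comp ha).mul h2
    have h4 : (fun k => compressionDet e c t (Q (σ k))) = fun k =>
        ((fun b : Fin n → EuclideanSpace ℂ (Fin d) => ∏ i, (t - ∑ j, c j * b i j)) ∘
          ((fun k i => (x k i : EuclideanSpace ℂ (Fin d))) ∘ σ)) k * gramDet e (Q (σ k)) := by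
      funext k
      rw [compressionDet_eq (hQ _), hx]
      rfl
    rw [h4] at h1
    have h5 := tendsto_nhds_unique h3 h1
    rw [compressionDet_eq hP, hy, he, mul_one, mul_one] at h5
    exact h5
  obtain ⟨s, hs⟩ := exists_perm_of_card_fiber_eq
    (fun i => (y i : EuclideanSpace ℂ (Fin d))) a
    (fun l => (card_fiber_eq_of_forall_prod_eq a _ hprod l).symm)
  have hev : ∀ i, ∀ᶠ k in Filter.atTop, phDist (x (σ k) i) (y (s i)) < ε := by
    intro i
    have hai : a i = (y (s i) : EuclideanSpace ℂ (Fin d)) := congrFun hs i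
    have h1 : Filter.Tendsto (fun k => (x (σ k) i : EuclideanSpace ℂ (Fin d))) Filter.atTop
        (nhds (y (s i) : EuclideanSpace ℂ (Fin d))) := by
      rw [← hai]
      exact ((continuous_apply i).tendsto a).comp ha
    have h2 := ((continuousAt_ballInvolution
      (mem_ball_zero_iff.1 (y (s i)).2)).tendsto.comp h1).norm
    rw [ballInvolution_self, norm_zero] at h2
    exact h2.eventually_lt_const hε
  obtain ⟨k, hk⟩ := (Filter.eventually_all.2 hev).exists
  exact ⟨σ k, s, hk⟩

end DruryArveson

end

/-! ### The spectral map: well-definedness, surjectivity, continuity -/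

open DruryArveson in
theorem theorem3p4 (d n : ℕ) (hd : 1 ≤ d) :
    ∃ Ψ : coinvariantProjections d n → SymPolyball d n,
      (∀ (P : coinvariantProjections d n) (l : EuclideanSpace ℂ (Fin d)),
        (Ψ P).mult l = jointSpectrumMult (compressedShift P.1) l) ∧
      Function.Surjective Ψ ∧
      ∀ P : coinvariantProjections d n, ∀ ε : ℝ, 0 < ε → ∃ δ : ℝ, 0 < δ ∧ ∀ Q : coinvariantProjections d n,
        ‖Q.1 - P.1‖ < δ → symDist (Ψ Q) (Ψ P) < ε := by
  choose x hx hdet using fun P : coinvariantProjections d n => exists_ball_spectral_tuple P.2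
  refine ⟨fun P => Quotient.mk (permSetoid d n) (x P), fun P l => hx P l, ?_, ?_⟩
  · intro X
    induction X using Quotient.inductionOn with
    | h y =>
      obtain ⟨P, hP, hmult⟩ := exists_projection_of_tuple hd y
      obtain ⟨s, hs⟩ := exists_perm_of_card_fiber_eq
        (fun i => (x ⟨P, hP⟩ i : EuclideanSpace ℂ (Fin d)))
        (fun i => (y i : EuclideanSpace ℂ (Fin d)))
        (fun l => (hx ⟨P, hP⟩ l).trans (hmult l))
      exact ⟨⟨P, hP⟩, Quotient.sound ⟨s, funext fun i => Subtype.ext (congrFun hs i)⟩⟩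
  · intro P ε hε
    by_contra! hcon
    -- A failure of continuity yields projections converging to P whose spectra all stay at distance
    -- at least ε.
    choose Q hQ1 hQ2 using fun k : ℕ => hcon (1 / ((k : ℝ) + 1)) (by positivity)
    have hlim : Filter.Tendsto (fun k => (Q k).1) Filter.atTop (nhds P.1) := by
      rw [tendsto_iff_norm_sub_tendsto_zero]
      exact squeeze_zero (fun _ => norm_nonneg _) (fun k => (hQ1 k).le)
        tendsto_one_div_add_atTop_nhds_zero_nat
    obtain ⟨k, s, hs⟩ := exists_subseq_phDist_lt P.2 (fun k => (Q k).2) hlim (hdet P)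
      (fun k => hdet (Q k)) hε
    exact absurd (symDist_mk_lt hε s hs) (not_lt.2 (hQ2 k))
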